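/- Write $\langle x\rangle=(1+x^2)^{1/2}$. There is an absolute constant $C>0$ with the following property. Let $m:\mathbb R\times\mathbb R\to\mathbb C$, $m=m(x,\xi)$, be smooth on $\mathbb R\times(\mathbb R\setminus\{0\})$ and let $B\in\mathbb R$ be such that $$\big|(\langle x\rangle\partial_x)^k m(x,\xi)\big|+\big|(\xi\partial_\xi)^\ell m(x,\xi)\big|\le B\qquad\text{for all }k,\ell\in\{0,1,2\},\ x\in\mathbb R,\ \xi\in\mathbb R\setminus\{0\}.$$ Then the operator $$(T_mf)(\xi)=\int_{\mathbb R}e^{ix\xi}\,m(x,\xi)\,f(x)\,dx,$$ given by this absolutely convergent integral for $\xi\neq0$ and $f\in L^1(\mathbb R)\cap L^2(\mathbb R)$, extends to a bounded linear operator $T_m$ on $L^2(\mathbb R)$ with $\|T_m\|_{L^2\to L^2}\le C\,B$. (The values of $m$ at $\xi=0$ play no role.) -/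

import Mathlib

open MeasureTheory
open scoped ContDiff ENNReal

/-- The bracket `⟨x⟩ = (1 + x ^ 2) ^ (1 / 2)`. -/
noncomputable def japBracket (x : ℝ) : ℝ := Real.sqrt (1 + x ^ 2)

/-- The operator `⟨x⟩ ∂_x` acting on functions of `(x, ξ)`. -/
noncomputable def bracketDx (m : ℝ → ℝ → ℂ) : ℝ → ℝ → ℂ :=
  fun x ξ => (japBracket x : ℂ) * deriv (fun y => m y ξ) x

/-- The operator `ξ ∂_ξ` acting on functions of `(x, ξ)`. -/
noncomputable def eulerDxi (m : ℝ → ℝ → ℂ) : ℝ → ℝ → ℂ :=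
  fun x ξ => (ξ : ℂ) * deriv (fun η => m x η) ξ

/-- The integral `∫ e ^ (i x ξ) m(x, ξ) f(x) dx`, which converges absolutely for every `ξ ≠ 0`
when `f` is integrable and `m` is continuous and bounded on `ξ ≠ 0`. -/
noncomputable def symbolIntegral (m : ℝ → ℝ → ℂ) (f : ℝ → ℂ) (ξ : ℝ) : ℂ :=
  ∫ x : ℝ, Complex.exp (Complex.I * (x : ℂ) * (ξ : ℂ)) * m x ξ * f x

open Filter Topology Set ComplexConjugate NNReal Function

/-! Let `T` be the operator and split `m` by means of the factor `1 / (1 + x²ξ²)`. The low part,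
living on `|xξ| ≲ 1`, needs no oscillation: its kernel is dominated by a multiple of `1 / (1 +
(xξ)²)`, which Schur's test with weight `|x|^(-1/2)` bounds on `L²` (`lintegral_hardy`).

For the high part `S`, consider the kernel `K(x, y)` of `S* w S`, where `w = 1 / (1 + lξ²)` only
serves to make integrals converge. Two integrations by parts in `ξ` give `|K(x, y)| ≲ √(|x||y|) / (x
- y)²` uniformly in `l` (`sq_mul_norm_gramKernel_highPart_le`). This is too singular on the
diagonal, so `K` is written as `Kρ + K(1 - ρ)` with `ρ = 4x²y² / (x² + y²)²`. Since `1 - ρ` vanishes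
to second order on the diagonal, `K(1 - ρ)` is `≲ √(|x||y|) / (x² + y²)`, and Schur's test applies
again (`enorm_form_one_sub_scaleCorr_le`).

The remaining piece `Kρ` is a superposition of localised forms: with `a_s(x) = x exp(-s x² / 2)` one
has `ρ(x, y) = ∫ 4s a_s(x)² a_s(y)² ds` over `s > 0`, so its form is `∫ 4s ‖w^(1/2) S a_s² f‖² ds`.
Here regularity in `x` enters: two integrations by parts in `x` show that `T a_s² T*` has a kernel
`≲ s^(-1/2) / (s + (ξ - η)²)` (`norm_gramKernel_bumpScale_le`). Hence `‖w^(1/2) T a_s‖² ≲ 1/s`, and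
the same holds for `S` because the low part is bounded and `a_s² ≤ 1/s`. The factor `s` cancels, and
`∫ a_s(x)² ds = 1` for `x ≠ 0` leaves a multiple of `‖f‖²` (`enorm_form_scaleCorr_le`). A continuous
family of scales thus plays the role of a dyadic decomposition.

Fatou's lemma removes `w` as `l → 0`, and density of `L¹ ∩ L²` in `L²` gives the operator. -/

/-! ### Calculus of second-order symbols on the punctured line -/

/-- `g` is twice differentiable off the origin, and `g`, `t g'`, `t² g''` are dominated by `b`. -/
def SymbolBound (g : ℝ → ℂ) (b : ℝ → ℝ) : Prop :=
  ∃ g₁ g₂ : ℝ → ℂ, ∀ t ≠ 0, HasDerivAt g (g₁ t) t ∧ HasDerivAt g₁ (g₂ t) t ∧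
    ‖g t‖ ≤ b t ∧ |t| * ‖g₁ t‖ ≤ b t ∧ t ^ 2 * ‖g₂ t‖ ≤ b t

lemma SymbolBound.mono {g : ℝ → ℂ} {b c : ℝ → ℝ} (h : SymbolBound g b)
    (hbc : ∀ t ≠ 0, b t ≤ c t) : SymbolBound g c := by
  obtain ⟨g₁, g₂, H⟩ := h
  refine ⟨g₁, g₂, fun t ht => ?_⟩
  obtain ⟨h1, h2, h3, h4, h5⟩ := H t ht
  have := hbc t ht
  exact ⟨h1, h2, h3.trans this, h4.trans this, h5.trans this⟩

/-- The Leibniz rule at second order produces four terms, each at most `b t * c t`; hence the factor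
4. -/
lemma SymbolBound.mul {g h : ℝ → ℂ} {b c : ℝ → ℝ} (hg : SymbolBound g b)
    (hh : SymbolBound h c) : SymbolBound (fun t => g t * h t) (fun t => 4 * (b t * c t)) := by
  obtain ⟨g₁, g₂, G⟩ := hg
  obtain ⟨h₁, h₂, H⟩ := hh
  refine ⟨fun t => g₁ t * h t + g t * h₁ t,
    fun t => (g₂ t * h t + g₁ t * h₁ t) + (g₁ t * h₁ t + g t * h₂ t), fun t ht => ?_⟩
  obtain ⟨a1, a2, a3, a4, a5⟩ := G t ht
  obtain ⟨b1, b2, b3, b4, b5⟩ := H t ht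
  have hb : 0 ≤ b t := (norm_nonneg _).trans a3
  have hc : 0 ≤ c t := (norm_nonneg _).trans b3
  have hbc := mul_nonneg hb hc
  have e1 : ‖g t‖ * ‖h t‖ ≤ b t * c t := mul_le_mul a3 b3 (norm_nonneg _) hb
  have e2 : (|t| * ‖g₁ t‖) * ‖h t‖ ≤ b t * c t := mul_le_mul a4 b3 (norm_nonneg _) hb
  have e3 : ‖g t‖ * (|t| * ‖h₁ t‖) ≤ b t * c t := mul_le_mul a3 b4 (by positivity) hb
  have e4 : (|t| * ‖g₁ t‖) * (|t| * ‖h₁ t‖) ≤ b t * c t := mul_le_mul a4 b4 (by positivity) hb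
  have e5 : (t ^ 2 * ‖g₂ t‖) * ‖h t‖ ≤ b t * c t := mul_le_mul a5 b3 (norm_nonneg _) hb
  have e6 : ‖g t‖ * (t ^ 2 * ‖h₂ t‖) ≤ b t * c t := mul_le_mul a3 b5 (by positivity) hb
  refine ⟨a1.mul b1, (a2.mul b1).add (a1.mul b2), ?_, ?_, ?_⟩
  · rw [norm_mul]; linarith
  · calc |t| * ‖g₁ t * h t + g t * h₁ t‖ ≤ |t| * (‖g₁ t‖ * ‖h t‖ + ‖g t‖ * ‖h₁ t‖) := by
          gcongr; exact (norm_add_le _ _).trans (by simp)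
      _ ≤ _ := by linarith
  · calc t ^ 2 * ‖(g₂ t * h t + g₁ t * h₁ t) + (g₁ t * h₁ t + g t * h₂ t)‖
        ≤ t ^ 2 * ((‖g₂ t‖ * ‖h t‖ + ‖g₁ t‖ * ‖h₁ t‖) + (‖g₁ t‖ * ‖h₁ t‖ + ‖g t‖ * ‖h₂ t‖)) := by
          gcongr
          refine (norm_add_le _ _).trans (add_le_add ?_ ?_) <;>
            exact (norm_add_le _ _).trans (by simp)
      _ ≤ _ := by rw [← sq_abs] at e5 e6 ⊢; linarith

lemma SymbolBound.conj {g : ℝ → ℂ} {b : ℝ → ℝ} (hg : SymbolBound g b) :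
    SymbolBound (fun t => conj (g t)) b := by
  obtain ⟨g₁, g₂, G⟩ := hg
  refine ⟨fun t => conj (g₁ t), fun t => conj (g₂ t), fun t ht => ?_⟩
  obtain ⟨a1, a2, a3, a4, a5⟩ := G t ht
  refine ⟨a1.star, a2.star, ?_, ?_, ?_⟩ <;> simpa

/-- Real-valued criterion for symbol bounds. -/
lemma SymbolBound.ofReal {g g₁ g₂ b : ℝ → ℝ}
    (h : ∀ t ≠ 0, HasDerivAt g (g₁ t) t ∧ HasDerivAt g₁ (g₂ t) t ∧
      |g t| ≤ b t ∧ |t * g₁ t| ≤ b t ∧ |t ^ 2 * g₂ t| ≤ b t) :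
    SymbolBound (fun t => (g t : ℂ)) b := by
  refine ⟨fun t => (g₁ t : ℂ), fun t => (g₂ t : ℂ), fun t ht => ?_⟩
  obtain ⟨a1, a2, a3, a4, a5⟩ := h t ht
  refine ⟨a1.ofReal_comp, a2.ofReal_comp, ?_, ?_, ?_⟩
  · simpa using a3
  · simpa [abs_mul] using a4
  · simpa [abs_mul] using a5

/-! ### Integration by parts across the origin -/

/-- The integral of the derivative of an integrable function which vanishes at the origin,
differentiability at the origin not being required. -/
lemma integral_deriv_eq_zero_of_tendsto {F F' : ℝ → ℂ} (hF : ∀ t ≠ 0, HasDerivAt F (F' t) t)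
    (h0 : Tendsto F (𝓝[≠] 0) (𝓝 0)) (hi : Integrable F) (hi' : Integrable F') :
    ∫ t, F' t = 0 := by
  set E := Function.update F 0 0 with hE
  have hEd : ∀ t ≠ 0, HasDerivAt E (F' t) t := fun t ht =>
    (hF t ht).congr_of_eventuallyEq (by
      filter_upwards [isOpen_ne.mem_nhds ht] with s hs
      exact Function.update_of_ne hs _ _)
  have hEc : ContinuousAt E 0 := continuousAt_update_same.2 h0
  have hEi : Integrable E := hi.congr (by
    filter_upwards [compl_mem_ae_iff.2 (measure_singleton (0 : ℝ))] with s hs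
    exact (Function.update_of_ne hs _ _).symm)
  have hE0 : E 0 = 0 := by simp [hE]
  have t1 : Tendsto E atTop (𝓝 0) := tendsto_zero_of_hasDerivAt_of_integrableOn_Ioi (a := 1)
    (fun x hx => hEd x (by have : (1:ℝ) < x := hx; positivity)) hi'.integrableOn hEi.integrableOn
  have t2 : Tendsto E atBot (𝓝 0) := tendsto_zero_of_hasDerivAt_of_integrableOn_Iic (a := -1)
    (fun x hx => hEd x (ne_of_lt (lt_of_le_of_lt hx (by norm_num)))) hi'.integrableOn hEi.integrableOn
  have i1 := integral_Ioi_of_hasDerivAt_of_tendsto hEc.continuousWithinAt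
    (fun x hx => hEd x (ne_of_gt hx)) hi'.integrableOn t1
  have i2 := integral_Iic_of_hasDerivAt_of_tendsto hEc.continuousWithinAt
    (fun x hx => hEd x (ne_of_lt hx)) hi'.integrableOn t2
  rw [← intervalIntegral.integral_Iic_add_Ioi hi'.integrableOn hi'.integrableOn, i1, i2]
  simp [hE0]

lemma SymbolBound.aestronglyMeasurable {g : ℝ → ℂ} {b : ℝ → ℝ} (hg : SymbolBound g b) :
    AEStronglyMeasurable g volume := by
  obtain ⟨g₁, g₂, G⟩ := hg
  have : ContinuousOn g {0}ᶜ := fun t ht => (G t ht).1.continuousAt.continuousWithinAt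
  have h := this.aestronglyMeasurable (μ := volume) (measurableSet_singleton (0:ℝ)).compl
  rwa [Measure.restrict_eq_self_of_ae_mem] at h
  exact compl_mem_ae_iff.2 (measure_singleton (0 : ℝ))

/-- Two integrations by parts. -/
lemma SymbolBound.sq_mul_norm_integral_le {g : ℝ → ℂ} {b : ℝ → ℝ} (hg : SymbolBound g b)
    (hb : Integrable b) (hb2 : Integrable (fun t => b t / t ^ 2))
    {c : ℝ} (hc : ∀ t ≠ 0, b t ≤ c * t ^ 2) (τ : ℝ) :
    τ ^ 2 * ‖∫ t : ℝ, Complex.exp (Complex.I * τ * t) * g t‖ ≤ ∫ t, b t / t ^ 2 := by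
  have hgm := hg.aestronglyMeasurable
  obtain ⟨g₁, g₂, G⟩ := hg
  have hne : ∀ᵐ t : ℝ, t ≠ 0 := compl_mem_ae_iff.2 (measure_singleton (0 : ℝ))
  have hg1m : AEStronglyMeasurable g₁ volume := by
    refine (stronglyMeasurable_deriv g).aestronglyMeasurable.congr ?_
    filter_upwards [hne] with t ht using (G t ht).1.deriv
  have hg2m : AEStronglyMeasurable g₂ volume := by
    refine (stronglyMeasurable_deriv g₁).aestronglyMeasurable.congr ?_
    filter_upwards [hne] with t ht using (G t ht).2.1.deriv
  have hexp : ∀ t : ℝ, ‖Complex.exp (Complex.I * τ * t)‖ = 1 := fun t => by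
    rw [show Complex.I * τ * t = ((τ * t : ℝ) : ℂ) * Complex.I by push_cast; ring]
    exact Complex.norm_exp_ofReal_mul_I _
  have hexpm : AEStronglyMeasurable (fun t : ℝ => Complex.exp (Complex.I * τ * t)) volume :=
    (by fun_prop : Continuous fun t : ℝ => Complex.exp (Complex.I * τ * t)).aestronglyMeasurable
  have n1 : ∀ t ≠ 0, ‖g₁ t‖ ≤ b t / |t| := fun t ht => by
    rw [le_div_iff₀ (by positivity), mul_comm]; exact (G t ht).2.2.2.1
  have n2 : ∀ t ≠ 0, ‖g₂ t‖ ≤ b t / t ^ 2 := fun t ht => by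
    rw [le_div_iff₀ (by positivity), mul_comm]; exact (G t ht).2.2.2.2
  have ig : Integrable g := hb.mono' hgm (by filter_upwards [hne] with t ht using (G t ht).2.2.1)
  have ig1 : Integrable g₁ := by
    -- The intermediate rate `b / |t|` lies below `b + b / t²`, because `|t| + 1 / |t| ≥ 1`.
    refine (hb.add hb2).mono' hg1m ?_
    filter_upwards [hne] with t ht
    have hbt : 0 ≤ b t := (norm_nonneg _).trans (G t ht).2.2.1
    refine (n1 t ht).trans ?_
    have ht' : 0 < |t| := abs_pos.2 ht
    simp only [Pi.add_apply]
    rw [← sq_abs t, div_le_iff₀ ht']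
    have : (b t + b t / |t| ^ 2) * |t| = b t * (|t| + 1 / |t|) := by field_simp
    rw [this]
    have : 1 ≤ |t| + 1 / |t| := by
      rw [← sub_nonneg]
      have : |t| + 1 / |t| - 1 = (|t| ^ 2 - |t| + 1) / |t| := by field_simp; ring
      rw [this]
      have : 0 ≤ |t| ^ 2 - |t| + 1 := by nlinarith [sq_nonneg (|t| - 1)]
      positivity
    nlinarith
  have ig2 : Integrable g₂ := hb2.mono' hg2m (by filter_upwards [hne] with t ht using n2 t ht)
  have iexp : ∀ {h : ℝ → ℂ}, Integrable h →
      Integrable (fun t : ℝ => Complex.exp (Complex.I * τ * t) * h t) := fun {h} hh =>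
    hh.bdd_mul hexpm (c := 1) (ae_of_all _ fun t => (hexp t).le)
  -- `e^(iτt) (iτ g - g')` packs both integrations by parts into one: its derivative is `-e^(iτt)
  -- (τ² g + g'')`.
  have key := integral_deriv_eq_zero_of_tendsto
    (F := fun t : ℝ => Complex.exp (Complex.I * τ * t) * (Complex.I * τ * g t - g₁ t))
    (F' := fun t : ℝ => Complex.exp (Complex.I * τ * t) * (-(τ ^ 2 * g t) - g₂ t)) ?_ ?_ ?_ ?_
  · have e : ∀ t : ℝ, Complex.exp (Complex.I * τ * t) * (-(τ ^ 2 * g t) - g₂ t)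
        = (-(τ : ℂ) ^ 2) * (Complex.exp (Complex.I * τ * t) * g t)
          - Complex.exp (Complex.I * τ * t) * g₂ t := fun t => by ring
    simp_rw [e] at key
    rw [integral_sub ((iexp ig).const_mul _) (iexp ig2), integral_const_mul, sub_eq_zero] at key
    have : τ ^ 2 * ‖∫ t : ℝ, Complex.exp (Complex.I * τ * t) * g t‖
        = ‖∫ t : ℝ, Complex.exp (Complex.I * τ * t) * g₂ t‖ := by
      rw [← key, norm_mul]; simp
    rw [this]
    refine norm_integral_le_of_norm_le hb2 ?_
    filter_upwards [hne] with t ht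
    rw [norm_mul, hexp, one_mul]; exact n2 t ht
  · intro t ht
    obtain ⟨a1, a2, -⟩ := G t ht
    have he : HasDerivAt (fun t : ℝ => Complex.exp (Complex.I * τ * t))
        (Complex.exp (Complex.I * τ * t) * (Complex.I * τ)) t := by
      have := ((Complex.ofRealCLM.hasDerivAt (x := t)).const_mul (Complex.I * (τ:ℂ))).cexp
      simpa using this
    refine (he.mul ((a1.const_mul (Complex.I * (τ:ℂ))).sub a2)).congr_deriv ?_
    simp only [Pi.sub_apply]
    linear_combination (Complex.exp (Complex.I * τ * t) * τ ^ 2 * g t) * Complex.I_sq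
  -- Quadratic vanishing of `b` at the origin makes `g` of size `t²` and `g'` of size `|t|`, so
  -- there is no boundary term.
  · rw [tendsto_zero_iff_norm_tendsto_zero]
    have : Tendsto (fun t : ℝ => |τ| * (c * t ^ 2) + c * |t|) (𝓝[≠] 0) (𝓝 0) := by
      have : Continuous (fun t : ℝ => |τ| * (c * t ^ 2) + c * |t|) := by fun_prop
      simpa using (this.tendsto 0).mono_left nhdsWithin_le_nhds
    refine squeeze_zero' (Eventually.of_forall fun _ => norm_nonneg _) ?_ this
    filter_upwards [self_mem_nhdsWithin] with t ht
    rw [norm_mul, hexp, one_mul]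
    refine (norm_sub_le _ _).trans (add_le_add ?_ ?_)
    · rw [norm_mul]
      simp only [norm_mul, Complex.norm_I, one_mul, Complex.norm_real, Real.norm_eq_abs]
      gcongr
      exact (G t ht).2.2.1.trans (hc t ht)
    · refine (n1 t ht).trans ?_
      have ht' : 0 < |t| := abs_pos.2 ht
      rw [div_le_iff₀ ht', mul_assoc, ← sq, sq_abs]
      exact hc t ht
  · exact iexp ((ig.const_mul _).sub ig1)
  · exact iexp ((ig.const_mul _).neg.sub ig2)

/-! ### Schur's test -/

lemma ae_ne_zero_real : ∀ᵐ t : ℝ, t ≠ 0 := compl_mem_ae_iff.2 (measure_singleton (0 : ℝ))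

/-- Schur's test for symmetric kernels. -/
lemma lintegral_schur {N : ℝ → ℝ → ℝ≥0∞} (hN : Measurable (uncurry N))
    (hsymm : ∀ x y, N x y = N y x) {p : ℝ → ℝ≥0} (hp : Measurable p) (hp0 : ∀ x ≠ 0, p x ≠ 0)
    {M : ℝ≥0∞} (hM : ∀ x ≠ 0, ∫⁻ y, N x y * p y ≤ M * p x) {F : ℝ → ℝ≥0} (hF : Measurable F) :
    ∫⁻ x, ∫⁻ y, (F x : ℝ≥0∞) * F y * N x y ≤ 2 * M * ∫⁻ x, (F x : ℝ≥0∞) ^ 2 := by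
  have hNx : ∀ x, Measurable (N x) := fun x => hN.of_uncurry_left
  have half : ∫⁻ x, ∫⁻ y, ((F x ^ 2 / p x * p y : ℝ≥0) : ℝ≥0∞) * N x y
      ≤ M * ∫⁻ x, (F x : ℝ≥0∞) ^ 2 := by
    rw [← lintegral_const_mul _ (by fun_prop)]
    refine lintegral_mono_ae ?_
    filter_upwards [ae_ne_zero_real] with x hx
    calc ∫⁻ y, ((F x ^ 2 / p x * p y : ℝ≥0) : ℝ≥0∞) * N x y
        = ((F x ^ 2 / p x : ℝ≥0) : ℝ≥0∞) * ∫⁻ y, N x y * p y := by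
          rw [← lintegral_const_mul _ (by have := hNx x; fun_prop)]
          refine lintegral_congr fun y => ?_
          push_cast; ring
      _ ≤ ((F x ^ 2 / p x : ℝ≥0) : ℝ≥0∞) * (M * p x) := by gcongr; exact hM x hx
      _ = M * ((F x ^ 2 / p x * p x : ℝ≥0) : ℝ≥0∞) := by push_cast; ring
      _ = M * (F x : ℝ≥0∞) ^ 2 := by rw [div_mul_cancel₀ _ (hp0 x hx)]; push_cast; rfl
  have swap : ∫⁻ x, ∫⁻ y, ((F y ^ 2 / p y * p x : ℝ≥0) : ℝ≥0∞) * N x y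
      = ∫⁻ x, ∫⁻ y, ((F x ^ 2 / p x * p y : ℝ≥0) : ℝ≥0∞) * N x y := by
    rw [lintegral_lintegral_swap]
    · refine lintegral_congr fun x => lintegral_congr fun y => ?_
      rw [hsymm]
    · exact (Measurable.mul (by fun_prop) hN).aemeasurable
  -- Arithmetic-geometric mean, `F x F y ≤ F x² p y / p x + F y² p x / p y`. The factor 1/2 is
  -- dropped, which is where the 2 in the conclusion comes from.
  calc ∫⁻ x, ∫⁻ y, (F x : ℝ≥0∞) * F y * N x y
      ≤ ∫⁻ x, ∫⁻ y, (((F x ^ 2 / p x * p y : ℝ≥0) : ℝ≥0∞) * N x y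
          + ((F y ^ 2 / p y * p x : ℝ≥0) : ℝ≥0∞) * N x y) := by
        refine lintegral_mono_ae ?_
        filter_upwards [ae_ne_zero_real] with x hx
        refine lintegral_mono_ae ?_
        filter_upwards [ae_ne_zero_real] with y hy
        rw [← add_mul]
        gcongr
        have h1 : 0 < p x := pos_iff_ne_zero.2 (hp0 x hx)
        have h2 : 0 < p y := pos_iff_ne_zero.2 (hp0 y hy)
        rw [← ENNReal.coe_mul, ← ENNReal.coe_add, ENNReal.coe_le_coe]
        rw [← NNReal.coe_le_coe]
        push_cast
        have h1' : (0:ℝ) < p x := h1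
        have h2' : (0:ℝ) < p y := h2
        have e : (F x : ℝ) ^ 2 / p x * p y + F y ^ 2 / p y * p x
            = ((F x * p y) ^ 2 + (F y * p x) ^ 2) / (p x * p y : ℝ) := by field_simp
        rw [e, le_div_iff₀ (by positivity)]
        nlinarith [sq_nonneg ((F x : ℝ) * p y - F y * p x), mul_nonneg (mul_nonneg (F x).2 h2'.le)
          (mul_nonneg (F y).2 h1'.le)]
    _ = (∫⁻ x, ∫⁻ y, ((F x ^ 2 / p x * p y : ℝ≥0) : ℝ≥0∞) * N x y)
          + ∫⁻ x, ∫⁻ y, ((F y ^ 2 / p y * p x : ℝ≥0) : ℝ≥0∞) * N x y := by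
        rw [← lintegral_add_left]
        · refine lintegral_congr fun x => lintegral_add_left ?_ _
          have := hNx x
          fun_prop
        · have : Measurable (fun z : ℝ × ℝ => ((F z.1 ^ 2 / p z.1 * p z.2 : ℝ≥0) : ℝ≥0∞)) := by
            fun_prop
          exact (this.mul hN).lintegral_prod_right'
    _ ≤ (M * ∫⁻ x, (F x : ℝ≥0∞) ^ 2) + M * ∫⁻ x, (F x : ℝ≥0∞) ^ 2 := by
        rw [swap]; exact add_le_add half half
    _ = _ := by ring

/-! ### The Hardy-type kernel `1 / (1 + (xξ)²)` -/

lemma lintegral_comp_mul_left_real {g : ℝ → ℝ≥0∞} (hg : Measurable g) {a : ℝ} (ha : a ≠ 0) :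
    ENNReal.ofReal |a| * ∫⁻ x, g (a * x) = ∫⁻ x, g x := by
  conv_rhs => rw [← Real.smul_map_volume_mul_left ha]
  rw [lintegral_smul_measure, lintegral_map hg (by fun_prop), smul_eq_mul]

lemma integrable_and_integral_inv_sq_add_sq {a : ℝ} (ha : 0 < a) :
    Integrable (fun t : ℝ => (a ^ 2 + t ^ 2)⁻¹) ∧ ∫ t : ℝ, (a ^ 2 + t ^ 2)⁻¹ = Real.pi / a := by
  have e : (fun t : ℝ => (a ^ 2 + t ^ 2)⁻¹)
      = fun t => (a ^ 2)⁻¹ * (1 + (a⁻¹ * t) ^ 2)⁻¹ := by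
    funext t
    rw [← mul_inv]
    congr 1
    field_simp
  have ha' : a⁻¹ ≠ 0 := by positivity
  refine ⟨?_, ?_⟩
  · rw [e]
    exact (integrable_inv_one_add_sq.comp_mul_left' ha').const_mul _
  · rw [e, integral_const_mul, Measure.integral_comp_mul_left (fun t : ℝ => (1 + t ^ 2)⁻¹),
      integral_univ_inv_one_add_sq, inv_inv, abs_of_pos ha, smul_eq_mul]
    field_simp

lemma lintegral_inv_sq_add_sq {a : ℝ} (ha : 0 < a) :
    ∫⁻ t : ℝ, ENNReal.ofReal (a ^ 2 + t ^ 2)⁻¹ = ENNReal.ofReal (Real.pi / a) := by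
  obtain ⟨h1, h2⟩ := integrable_and_integral_inv_sq_add_sq ha
  rw [← h2, ofReal_integral_eq_lintegral_ofReal h1 (ae_of_all _ fun t => by positivity)]

/-- The weight `|x| ^ (-1/2)`. -/
noncomputable def invSqrtWeight (x : ℝ) : ℝ≥0 := (NNReal.sqrt ‖x‖₊)⁻¹

lemma measurable_invSqrtWeight : Measurable invSqrtWeight := by
  unfold invSqrtWeight; fun_prop

lemma invSqrtWeight_ne_zero {x : ℝ} (hx : x ≠ 0) : invSqrtWeight x ≠ 0 := by
  unfold invSqrtWeight; simpa using hx

lemma coe_invSqrtWeight (x : ℝ) : (invSqrtWeight x : ℝ) = (Real.sqrt |x|)⁻¹ := by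
  unfold invSqrtWeight; simp

/-- The eigenvalue of the kernel `1 / (1 + (ξx)²)` on the weight `|x|^(-1/2)`. -/
noncomputable def hardyConst : ℝ≥0∞ :=
  ∫⁻ t : ℝ, ENNReal.ofReal (1 + t ^ 2)⁻¹ * invSqrtWeight t

/-- The integrand is at most `t^(-1/2)` on `(0, 1]` and at most `(1 + t²)⁻¹` beyond 1; evenness
handles the negative half-line. -/
lemma hardyConst_lt_top : hardyConst < ⊤ := by
  have e : hardyConst = ∫⁻ t : ℝ, ENNReal.ofReal ((1 + t ^ 2)⁻¹ * (Real.sqrt |t|)⁻¹) := by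
    unfold hardyConst
    refine lintegral_congr fun t => ?_
    rw [ENNReal.ofReal_mul (by positivity), ← coe_invSqrtWeight, ENNReal.ofReal_coe_nnreal]
  rw [e]
  set h : ℝ → ℝ := fun t => (1 + t ^ 2)⁻¹ * (Real.sqrt |t|)⁻¹ with hh
  have hm : Measurable h := by fun_prop
  have h1 : IntegrableOn h (Ioc 0 1) := by
    have := (intervalIntegrable_iff_integrableOn_Ioc_of_le zero_le_one).1
      (intervalIntegral.intervalIntegrable_rpow' (a := 0) (b := 1) (r := -(1/2)) (by norm_num))
    refine this.mono' hm.aestronglyMeasurable ?_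
    filter_upwards [ae_restrict_mem measurableSet_Ioc] with t ht
    have e : t ^ (-(1/2) : ℝ) = (Real.sqrt |t|)⁻¹ := by
      rw [abs_of_pos ht.1, Real.sqrt_eq_rpow, Real.rpow_neg ht.1.le]
    rw [e, Real.norm_of_nonneg (by positivity)]
    exact mul_le_of_le_one_left (by positivity) (inv_le_one_of_one_le₀ (by nlinarith [sq_nonneg t]))
  have h2 : IntegrableOn h (Ioi 1) := by
    refine integrable_inv_one_add_sq.integrableOn.mono' hm.aestronglyMeasurable ?_
    filter_upwards [ae_restrict_mem measurableSet_Ioi] with t ht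
    have ht : 1 < t := ht
    rw [Real.norm_of_nonneg (by positivity)]
    refine mul_le_of_le_one_right (by positivity) (inv_le_one_of_one_le₀ ?_)
    rw [Real.one_le_sqrt, abs_of_pos (by linarith)]
    exact ht.le
  have h3 : IntegrableOn h (Ioi 0) := by
    rw [← Ioc_union_Ioi_eq_Ioi zero_le_one]; exact h1.union h2
  have h4 : IntegrableOn h (Iic 0) := by
    have := integrableOn_Ici_iff_integrableOn_Ioi (by simp) |>.2 h3
    have := IntegrableOn.comp_neg_Iic (c := 0) (f := h) (by simpa using this)
    simpa [hh] using this
  have h5 : Integrable h := by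
    rw [← integrableOn_univ, ← Iic_union_Ioi (a := (0:ℝ))]; exact h4.union h3
  exact h5.lintegral_lt_top

/-- The kernel depends on the product `ξx` only, so substituting `t = ξx` makes the homogeneous
weight an eigenfunction; the exponent `-1/2` is the one reproduced by the Jacobian. -/
lemma lintegral_hardy_weight {ξ : ℝ} (hξ : ξ ≠ 0) :
    ∫⁻ x : ℝ, ENNReal.ofReal (1 + (ξ * x) ^ 2)⁻¹ * invSqrtWeight x
      = hardyConst * invSqrtWeight ξ := by
  have hs := lintegral_comp_mul_left_real
    (g := fun t => ENNReal.ofReal (1 + t ^ 2)⁻¹ * invSqrtWeight t)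
    (by have := measurable_invSqrtWeight; fun_prop) hξ
  have hmul : ∀ x, invSqrtWeight (ξ * x) = invSqrtWeight ξ * invSqrtWeight x := fun x => by
    rw [invSqrtWeight, nnnorm_mul, NNReal.sqrt_mul, mul_inv]; rfl
  have h0 := invSqrtWeight_ne_zero hξ
  have hsq : ENNReal.ofReal |ξ| * (invSqrtWeight ξ) = ((invSqrtWeight ξ)⁻¹ : ℝ≥0) := by
    rw [← Real.norm_eq_abs, ofReal_norm, enorm_eq_nnnorm, ← ENNReal.coe_mul]
    congr 1
    rw [← mul_eq_one_iff_eq_inv₀ h0, mul_assoc, ← sq, invSqrtWeight, inv_pow, NNReal.sq_sqrt]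
    exact mul_inv_cancel₀ (by simpa using hξ)
  unfold hardyConst
  rw [← hs]
  simp only [hmul]
  have : ∀ x : ℝ, ENNReal.ofReal (1 + (ξ * x) ^ 2)⁻¹ * ((invSqrtWeight ξ * invSqrtWeight x : ℝ≥0) : ℝ≥0∞)
      = invSqrtWeight ξ * (ENNReal.ofReal (1 + (ξ * x) ^ 2)⁻¹ * invSqrtWeight x) := fun x => by
    push_cast; ring
  simp only [this]
  rw [lintegral_const_mul _ (by have := measurable_invSqrtWeight; fun_prop), ← mul_assoc, hsq,
    mul_comm, ← mul_assoc, ← ENNReal.coe_mul, mul_inv_cancel₀ h0]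
  simp

lemma lintegral_hardy {F : ℝ → ℝ≥0} (hF : Measurable F) :
    ∫⁻ ξ : ℝ, (∫⁻ x : ℝ, ENNReal.ofReal (1 + (ξ * x) ^ 2)⁻¹ * F x) ^ 2
      ≤ 2 * hardyConst ^ 2 * ∫⁻ x, (F x : ℝ≥0∞) ^ 2 := by
  have hw := measurable_invSqrtWeight
  set M : ℝ → ℝ → ℝ≥0∞ := fun ξ x => ENNReal.ofReal (1 + (ξ * x) ^ 2)⁻¹ with hMdef
  have hM : Measurable (uncurry M) := by
    simp only [hMdef, uncurry_def]; fun_prop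
  have hMs : ∀ ξ x, M ξ x = M x ξ := fun ξ x => by simp only [hMdef, mul_comm]
  have hMl : ∀ ξ, Measurable (M ξ) := fun ξ => hM.of_uncurry_left
  have hMr : ∀ x, Measurable (fun ξ => M ξ x) := fun x => hM.of_uncurry_right
  -- The squared `L²` norm is the quadratic form of `M` composed with itself, for which the weight
  -- has eigenvalue `hardyConst ^ 2`.
  set N : ℝ → ℝ → ℝ≥0∞ := fun x y => ∫⁻ ξ, M ξ x * M ξ y with hN
  have hNm : Measurable (uncurry N) := by
    have : Measurable (fun z : (ℝ × ℝ) × ℝ => M z.2 z.1.1 * M z.2 z.1.2) := by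
      simp only [hMdef]; fun_prop
    exact this.lintegral_prod_right'
  have key := lintegral_schur hNm (fun x y => by simp only [hN, mul_comm]) hw
    (fun x hx => invSqrtWeight_ne_zero hx) (M := hardyConst ^ 2) ?_ hF
  · refine le_trans (le_of_eq ?_) key
    have e : ∀ ξ, (∫⁻ x, M ξ x * F x) ^ 2 = ∫⁻ x, ∫⁻ y, (F x : ℝ≥0∞) * F y * (M ξ x * M ξ y) := by
      intro ξ
      rw [sq, ← lintegral_lintegral_mul (by have := hMl ξ; fun_prop)
        (by have := hMl ξ; fun_prop)]
      refine lintegral_congr fun x => lintegral_congr fun y => by ring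
    refine (lintegral_congr e).trans ?_
    rw [lintegral_lintegral_swap]
    · refine lintegral_congr fun x => ?_
      rw [lintegral_lintegral_swap]
      · refine lintegral_congr fun y => ?_
        rw [lintegral_const_mul _ (by have := hMr x; have := hMr y; fun_prop)]
      · simp only [hMdef, uncurry_def]; fun_prop
    · refine Measurable.aemeasurable ?_
      have : Measurable (fun z : (ℝ × ℝ) × ℝ =>
          (F z.1.2 : ℝ≥0∞) * F z.2 * (M z.1.1 z.1.2 * M z.1.1 z.2)) := by
        simp only [hMdef]; fun_prop
      exact this.lintegral_prod_right'
  · intro x hx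
    have : ∀ y, N x y * invSqrtWeight y = ∫⁻ ξ, M ξ x * (M ξ y * invSqrtWeight y) := fun y => by
      change (∫⁻ ξ, M ξ x * M ξ y) * _ = _
      rw [← lintegral_mul_const _ (by have := hMr x; have := hMr y; fun_prop)]
      refine lintegral_congr fun ξ => by ring
    simp only [this]
    rw [lintegral_lintegral_swap (by simp only [hMdef, uncurry_def]; fun_prop)]
    calc ∫⁻ ξ, ∫⁻ y, M ξ x * (M ξ y * invSqrtWeight y)
        ≤ ∫⁻ ξ, hardyConst * (M x ξ * invSqrtWeight ξ) := by
          refine lintegral_mono_ae ?_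
          filter_upwards [ae_ne_zero_real] with ξ hξ
          rw [lintegral_const_mul _ (by have := hMl ξ; fun_prop), lintegral_hardy_weight hξ, hMs]
          exact le_of_eq (by ring)
      _ = hardyConst ^ 2 * invSqrtWeight x := by
          rw [lintegral_const_mul _ (by have := hMl x; fun_prop), lintegral_hardy_weight hx]
          ring

/-! ### Kernel operators, Gram kernels and the `T T*` argument -/

/-- The integral operator with kernel `k`. -/
noncomputable def kernelOp (k : ℝ → ℝ → ℂ) (f : ℝ → ℂ) (ξ : ℝ) : ℂ := ∫ x, k x ξ * f x

/-- The kernel of `T* v T` where `T` is the integral operator with kernel `k`. -/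
noncomputable def gramKernel (k : ℝ → ℝ → ℂ) (v : ℝ → ℝ) (x y : ℝ) : ℂ :=
  ∫ ξ, (v ξ : ℂ) * (conj (k x ξ) * k y ξ)

section

variable {k : ℝ → ℝ → ℂ} {c : ℝ} {v : ℝ → ℝ} {f : ℝ → ℂ}

lemma measurable_kernelOp (hk : Measurable (uncurry k)) (hf : Measurable f) :
    Measurable (kernelOp k f) := by
  have : Measurable (fun z : ℝ × ℝ => k z.2 z.1 * f z.2) :=
    (hk.comp measurable_swap).mul (hf.comp measurable_snd)
  exact this.stronglyMeasurable.integral_prod_right'.measurable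

lemma norm_kernelOp_le (hc : ∀ x ξ, ‖k x ξ‖ ≤ c) (hf : Integrable f) (ξ : ℝ) :
    ‖kernelOp k f ξ‖ ≤ c * ∫ x, ‖f x‖ := by
  rw [← integral_const_mul]
  refine norm_integral_le_of_norm_le (hf.norm.const_mul c) (ae_of_all _ fun x => ?_)
  rw [norm_mul]
  gcongr
  exact hc x ξ

lemma integrable_kernel_mul (hk : Measurable (uncurry k)) (hc : ∀ x ξ, ‖k x ξ‖ ≤ c)
    (hf : Integrable f) (ξ : ℝ) : Integrable (fun x => k x ξ * f x) :=
  hf.bdd_mul hk.of_uncurry_right.aestronglyMeasurable (c := c) (ae_of_all _ fun x => hc x ξ)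

lemma measurable_gramKernel (hk : Measurable (uncurry k)) (hv : Measurable v) :
    Measurable (uncurry (gramKernel k v)) := by
  have : Measurable (fun z : (ℝ × ℝ) × ℝ => (v z.2 : ℂ) * (conj (k z.1.1 z.2) * k z.1.2 z.2)) := by
    have h1 : Measurable fun z : (ℝ × ℝ) × ℝ => k z.1.1 z.2 :=
      hk.comp (by fun_prop : Measurable fun z : (ℝ × ℝ) × ℝ => (z.1.1, z.2))
    have h2 : Measurable fun z : (ℝ × ℝ) × ℝ => k z.1.2 z.2 :=
      hk.comp (by fun_prop : Measurable fun z : (ℝ × ℝ) × ℝ => (z.1.2, z.2))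
    exact (by fun_prop : Measurable fun z : (ℝ × ℝ) × ℝ => (v z.2 : ℂ)).mul
      ((Complex.continuous_conj.measurable.comp h1).mul h2)
  exact this.stronglyMeasurable.integral_prod_right'.measurable

/-- A purely qualitative bound: it depends on the mass of `v`, and serves to make the quadratic
forms absolutely convergent. -/
lemma norm_gramKernel_le (hc : ∀ x ξ, ‖k x ξ‖ ≤ c) (hv : Integrable v) (hv0 : ∀ ξ, 0 ≤ v ξ)
    (x y : ℝ) : ‖gramKernel k v x y‖ ≤ c ^ 2 * ∫ ξ, v ξ := by
  rw [← integral_const_mul]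
  refine norm_integral_le_of_norm_le (hv.const_mul _) (ae_of_all _ fun ξ => ?_)
  have h0 : 0 ≤ c := (norm_nonneg _).trans (hc x ξ)
  rw [norm_mul, norm_mul, RCLike.norm_conj, Complex.norm_real, Real.norm_of_nonneg (hv0 ξ),
    mul_comm, sq]
  exact mul_le_mul_of_nonneg_right (mul_le_mul (hc _ _) (hc _ _) (norm_nonneg _) h0) (hv0 ξ)

lemma lintegral_weight_enorm_sq_eq {u : ℝ → ℂ} (hu : Measurable u) {d : ℝ} (hd : ∀ ξ, ‖u ξ‖ ≤ d)
    (hv : Integrable v) (hv0 : ∀ ξ, 0 ≤ v ξ) :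
    ∫⁻ ξ, ENNReal.ofReal (v ξ) * ‖u ξ‖ₑ ^ 2 = ‖∫ ξ, (v ξ : ℂ) * (conj (u ξ) * u ξ)‖ₑ := by
  have e1 : ∀ ξ, (v ξ : ℂ) * (conj (u ξ) * u ξ) = ((v ξ * ‖u ξ‖ ^ 2 : ℝ) : ℂ) := fun ξ => by
    rw [mul_comm (conj _), Complex.mul_conj, Complex.normSq_eq_norm_sq]; push_cast; ring
  have hint : Integrable (fun ξ => v ξ * ‖u ξ‖ ^ 2) := by
    refine hv.mul_bdd (c := d ^ 2) (by fun_prop) (ae_of_all _ fun ξ => ?_)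
    rw [Real.norm_of_nonneg (by positivity)]
    gcongr
    exact hd ξ
  simp_rw [e1]
  rw [integral_complex_ofReal, ← ofReal_norm, Complex.norm_real, Real.norm_of_nonneg
    (integral_nonneg fun ξ => mul_nonneg (hv0 ξ) (by positivity)),
    ofReal_integral_eq_lintegral_ofReal hint (ae_of_all _ fun ξ => mul_nonneg (hv0 ξ) (by positivity))]
  refine lintegral_congr fun ξ => ?_
  rw [ENNReal.ofReal_mul (hv0 ξ), ENNReal.ofReal_pow (norm_nonneg _), ofReal_norm]

/-- The quadratic form of `T* v T`. -/
lemma lintegral_weight_kernelOp_sq (hk : Measurable (uncurry k)) (hc : ∀ x ξ, ‖k x ξ‖ ≤ c)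
    (hv : Integrable v) (hv0 : ∀ ξ, 0 ≤ v ξ) (hfm : Measurable f)
    (hf : Integrable f) :
    ∫⁻ ξ, ENNReal.ofReal (v ξ) * ‖kernelOp k f ξ‖ₑ ^ 2
      = ‖∫ z : ℝ × ℝ, conj (f z.1) * f z.2 * gramKernel k v z.1 z.2‖ₑ := by
  rw [lintegral_weight_enorm_sq_eq (measurable_kernelOp hk hfm)
    (norm_kernelOp_le hc hf) hv hv0]
  congr 1
  have e : ∀ ξ, (v ξ : ℂ) * (conj (kernelOp k f ξ) * kernelOp k f ξ)
      = ∫ z : ℝ × ℝ, (v ξ : ℂ) * (conj (k z.1 ξ * f z.1) * (k z.2 ξ * f z.2)) := by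
    intro ξ
    rw [integral_const_mul]
    congr 1
    unfold kernelOp
    rw [← integral_conj, Measure.volume_eq_prod, ← integral_prod_mul]
  simp_rw [e]
  rw [integral_integral_swap]
  · refine integral_congr_ae (ae_of_all _ fun z => ?_)
    dsimp only
    rw [gramKernel, ← integral_const_mul]
    refine integral_congr_ae (ae_of_all _ fun ξ => ?_)
    simp only [map_mul]
    ring
  · have hdom : Integrable (fun p : ℝ × (ℝ × ℝ) => v p.1 * (c ^ 2 * (‖f p.2.1‖ * ‖f p.2.2‖)))
        (volume.prod volume) := by
      refine Integrable.mul_prod (f := v) (g := fun z : ℝ × ℝ => c ^ 2 * (‖f z.1‖ * ‖f z.2‖)) hv ?_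
      exact (hf.norm.mul_prod hf.norm).const_mul _
    have hvm : AEStronglyMeasurable (fun p : ℝ × (ℝ × ℝ) => (v p.1 : ℂ)) (volume.prod volume) :=
      (Complex.continuous_ofReal.comp_aestronglyMeasurable hv.aestronglyMeasurable).comp_fst
    refine hdom.mono' ?_ (ae_of_all _ fun p => ?_)
    · refine hvm.mul (Measurable.aestronglyMeasurable ?_)
      have h1 : Measurable fun p : ℝ × (ℝ × ℝ) => k p.2.1 p.1 :=
        hk.comp (by fun_prop : Measurable fun p : ℝ × (ℝ × ℝ) => (p.2.1, p.1))
      have h2 : Measurable fun p : ℝ × (ℝ × ℝ) => k p.2.2 p.1 :=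
        hk.comp (by fun_prop : Measurable fun p : ℝ × (ℝ × ℝ) => (p.2.2, p.1))
      exact (Complex.continuous_conj.measurable.comp (h1.mul (by fun_prop))).mul
        (h2.mul (by fun_prop))
    · simp only [uncurry, norm_mul, RCLike.norm_conj, Complex.norm_real,
        Real.norm_of_nonneg (hv0 p.1)]
      have h0 : 0 ≤ c := (norm_nonneg _).trans (hc 0 0)
      have := mul_le_mul (hc p.2.1 p.1) (hc p.2.2 p.1) (norm_nonneg _) h0
      refine mul_le_mul_of_nonneg_left ?_ (hv0 _)
      calc _ = (‖k p.2.1 p.1‖ * ‖k p.2.2 p.1‖) * (‖f p.2.1‖ * ‖f p.2.2‖) := by ring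
        _ ≤ (c * c) * (‖f p.2.1‖ * ‖f p.2.2‖) := by gcongr
        _ = _ := by ring

lemma enorm_integral_form_le {G : ℝ → ℝ → ℂ} (hG : Measurable (uncurry G)) (hfm : Measurable f) :
    ‖∫ z : ℝ × ℝ, conj (f z.1) * f z.2 * G z.1 z.2‖ₑ
      ≤ ∫⁻ x, ∫⁻ y, (‖f x‖₊ : ℝ≥0∞) * ‖f y‖₊ * ‖G x y‖ₑ := by
  refine (enorm_integral_le_lintegral_enorm _).trans (le_of_eq ?_)
  rw [Measure.volume_eq_prod, lintegral_prod]
  · refine lintegral_congr fun x => lintegral_congr fun y => ?_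
    rw [enorm_mul, enorm_mul, RCLike.enorm_conj]; rfl
  · refine (Measurable.enorm ?_).aemeasurable
    exact ((Complex.continuous_conj.measurable.comp (hfm.comp measurable_fst)).mul
      (hfm.comp measurable_snd)).mul hG

/-- The `T T*` argument for a weighted kernel operator. -/
lemma lintegral_weight_kernelOp_sq_le_of_adjoint (hk : Measurable (uncurry k))
    (hc : ∀ x ξ, ‖k x ξ‖ ≤ c) (hv : Integrable v) (hv0 : ∀ ξ, 0 ≤ v ξ) (hv1 : ∀ ξ, v ξ ≤ 1)
    (hvm : Measurable v)
    {a : ℝ → ℝ} (ham : Measurable a) {d : ℝ} (had : ∀ x, |a x| ≤ d)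
    (ha : Integrable (fun x => a x ^ 2)) {N : ℝ → ℝ → ℝ≥0∞} (hNm : Measurable (uncurry N))
    (hsymm : ∀ ξ η, N ξ η = N η ξ)
    (hN : ∀ ξ η, ‖gramKernel (fun ξ x => k x ξ) (fun x => a x ^ 2) ξ η‖ₑ ≤ N ξ η)
    {M : ℝ≥0} (hM0 : 0 < M) (hM : ∀ ξ, ∫⁻ η, N ξ η ≤ M)
    (hfm : Measurable f) (hf : Integrable f) :
    ∫⁻ ξ, ENNReal.ofReal (v ξ) * ‖kernelOp k (fun x => a x * f x) ξ‖ₑ ^ 2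
      ≤ 2 * M * ∫⁻ x, ‖f x‖ₑ ^ 2 := by
  have hafm : Measurable (fun x => (a x : ℂ) * f x) := by fun_prop
  have haf : Integrable (fun x => (a x : ℂ) * f x) :=
    hf.bdd_mul (by fun_prop) (c := d) (ae_of_all _ fun x => by simpa using had x)
  set u := kernelOp k (fun x => a x * f x) with hu
  have hum : Measurable u := measurable_kernelOp hk hafm
  have hub := norm_kernelOp_le hc haf
  rw [← hu] at hub
  -- With this choice `V` below is the complex conjugate of `T*(v u)`.
  set q : ℝ → ℂ := fun ξ => (v ξ : ℂ) * conj (u ξ) with hq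
  have hqm : Measurable q := by
    have := Complex.continuous_conj.measurable.comp hum
    exact Measurable.mul (by fun_prop) this
  have hqi : Integrable q :=
    hv.ofReal.mul_bdd (Complex.continuous_conj.measurable.comp hum).aestronglyMeasurable
      (ae_of_all _ fun ξ => by simpa using hub ξ)
  set V := kernelOp (fun ξ x => k x ξ) q with hV
  have hk' : Measurable (uncurry fun ξ x => k x ξ) := hk.comp measurable_swap
  have hVm : Measurable V := measurable_kernelOp hk' hqm
  set X := ∫⁻ ξ, ENNReal.ofReal (v ξ) * ‖u ξ‖ₑ ^ 2 with hX
  -- Finiteness is what allows `X / 2` to be absorbed at the end; it comes from the integrable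
  -- weight and the boundedness of `u`.
  have hXtop : X ≠ ⊤ := by
    rw [hX, lintegral_weight_enorm_sq_eq hum hub hv hv0]; exact enorm_ne_top
  have hVbound : ∫⁻ x, ENNReal.ofReal (a x ^ 2) * ‖V x‖ₑ ^ 2 ≤ 2 * M * X := by
    rw [hV, lintegral_weight_kernelOp_sq hk' (fun ξ x => hc x ξ) ha (fun x => sq_nonneg _) hqm hqi]
    refine (enorm_integral_form_le (measurable_gramKernel hk' (ham.pow_const 2)) hqm).trans ?_
    calc ∫⁻ ξ, ∫⁻ η, (‖q ξ‖₊ : ℝ≥0∞) * ‖q η‖₊ *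
          ‖gramKernel (fun ξ x => k x ξ) (fun x => a x ^ 2) ξ η‖ₑ
        ≤ ∫⁻ ξ, ∫⁻ η, (‖q ξ‖₊ : ℝ≥0∞) * ‖q η‖₊ * N ξ η := by
          refine lintegral_mono fun ξ => lintegral_mono fun η => ?_
          gcongr
          exact hN ξ η
      _ ≤ 2 * M * ∫⁻ ξ, (‖q ξ‖₊ : ℝ≥0∞) ^ 2 :=
          lintegral_schur hNm hsymm (p := fun _ => 1) (by fun_prop) (by simp)
            (by simpa using fun x _ => hM x) (by fun_prop)
      _ ≤ 2 * M * X := by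
          gcongr
          refine lintegral_mono fun ξ => ?_
          change ‖(v ξ : ℂ) * conj (u ξ)‖ₑ ^ 2 ≤ ENNReal.ofReal (v ξ) * ‖u ξ‖ₑ ^ 2
          rw [enorm_mul, RCLike.enorm_conj, mul_pow]
          gcongr
          rw [← ofReal_norm, Complex.norm_real, Real.norm_of_nonneg (hv0 ξ),
            ← ENNReal.ofReal_pow (hv0 ξ)]
          refine ENNReal.ofReal_le_ofReal ?_
          nlinarith [hv0 ξ, hv1 ξ]
  have hpair : X ≤ ∫⁻ x, ‖f x‖ₑ * ‖(a x : ℂ) * V x‖ₑ := by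
    have e : ∫ ξ, (v ξ : ℂ) * (conj (u ξ) * u ξ) = ∫ x, f x * ((a x : ℂ) * V x) := by
      have e1 : ∀ ξ, (v ξ : ℂ) * (conj (u ξ) * u ξ) = ∫ x, q ξ * (k x ξ * (a x * f x)) := by
        intro ξ
        rw [integral_const_mul, ← mul_assoc]; rfl
      have e2 : ∀ x, f x * ((a x : ℂ) * V x) = ∫ ξ, q ξ * (k x ξ * (a x * f x)) := by
        intro x
        rw [hV, kernelOp, ← mul_assoc, ← integral_const_mul]
        refine integral_congr_ae (ae_of_all _ fun ξ => ?_)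
        ring
      simp_rw [e1, e2]
      refine integral_integral_swap ?_
      have hdom := (hqi.norm.mul_prod haf.norm).const_mul c
      refine hdom.mono' (Measurable.aestronglyMeasurable ?_) (ae_of_all _ fun p => ?_)
      · exact (hqm.comp measurable_fst).mul
          ((hk.comp measurable_swap).mul (hafm.comp measurable_snd))
      · simp only [uncurry]
        rw [norm_mul, norm_mul (k p.2 p.1), mul_left_comm]
        gcongr
        exact hc _ _
    rw [hX, lintegral_weight_enorm_sq_eq hum hub hv hv0, e]
    refine (enorm_integral_le_lintegral_enorm _).trans (le_of_eq ?_)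
    exact lintegral_congr fun x => enorm_mul _ _
  -- Young's inequality balanced so that `(4M)⁻¹` times the bound `2 M X` for the `V` term is
  -- exactly `X / 2`.
  have hyoung : ∀ x, ‖f x‖ₑ * ‖(a x : ℂ) * V x‖ₑ
      ≤ M * ‖f x‖ₑ ^ 2 + ((4 * M)⁻¹ : ℝ≥0) * (ENNReal.ofReal (a x ^ 2) * ‖V x‖ₑ ^ 2) := by
    intro x
    have e : ENNReal.ofReal (a x ^ 2) * ‖V x‖ₑ ^ 2 = ‖(a x : ℂ) * V x‖ₑ ^ 2 := by
      rw [enorm_mul, mul_pow, ← sq_abs, ENNReal.ofReal_pow (abs_nonneg _)]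
      congr 2
      rw [← ofReal_norm, Complex.norm_real, Real.norm_eq_abs]
    rw [e]
    simp only [enorm_eq_nnnorm]
    norm_cast
    rw [← NNReal.coe_le_coe]
    push_cast
    have hM' : (0:ℝ) < M := hM0
    set s := ‖f x‖
    set t := ‖(a x : ℂ) * V x‖
    have : (M:ℝ) * s ^ 2 + (4 * (M:ℝ))⁻¹ * t ^ 2 - s * t = (4 * (M:ℝ))⁻¹ * (2 * M * s - t) ^ 2 := by
      field_simp; ring
    have : 0 ≤ (4 * (M:ℝ))⁻¹ * (2 * M * s - t) ^ 2 := by positivity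
    linarith
  have hfin : X ≤ M * (∫⁻ x, ‖f x‖ₑ ^ 2) + 2⁻¹ * X := by
    calc X ≤ ∫⁻ x, (M * ‖f x‖ₑ ^ 2
          + ((4 * M)⁻¹ : ℝ≥0) * (ENNReal.ofReal (a x ^ 2) * ‖V x‖ₑ ^ 2)) :=
          hpair.trans (lintegral_mono hyoung)
      _ = M * (∫⁻ x, ‖f x‖ₑ ^ 2)
          + ((4 * M)⁻¹ : ℝ≥0) * ∫⁻ x, ENNReal.ofReal (a x ^ 2) * ‖V x‖ₑ ^ 2 := by
          rw [lintegral_add_left (by fun_prop), lintegral_const_mul _ (by fun_prop),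
            lintegral_const_mul _ (by fun_prop)]
      _ ≤ M * (∫⁻ x, ‖f x‖ₑ ^ 2) + ((4 * M)⁻¹ : ℝ≥0) * (2 * M * X) := by gcongr
      _ = _ := by
          congr 1
          rw [← mul_assoc]
          congr 1
          have : (4 * M)⁻¹ * (2 * M) = (2⁻¹ : ℝ≥0) := by field_simp; norm_num
          have h2 := congrArg (fun r : ℝ≥0 => (r : ℝ≥0∞)) this
          simpa using h2
  have hhalf : X = 2⁻¹ * X + 2⁻¹ * X := by
    rw [← add_mul, ENNReal.inv_two_add_inv_two, one_mul]
  have h2X : 2⁻¹ * X ≠ ⊤ := ENNReal.mul_ne_top (by simp) hXtop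
  have h3 : 2⁻¹ * X ≤ M * ∫⁻ x, ‖f x‖ₑ ^ 2 := by
    rw [hhalf] at hfin
    nth_rw 2 [← hhalf] at hfin
    exact (ENNReal.add_le_add_iff_right h2X).1 hfin
  calc X = 2 * (2⁻¹ * X) := by
        rw [← mul_assoc, ENNReal.mul_inv_cancel (by simp) (by simp), one_mul]
    _ ≤ 2 * (M * ∫⁻ x, ‖f x‖ₑ ^ 2) := by gcongr
    _ = _ := by ring

end

/-! ### Cauchy cutoffs as symbols -/

/-- The weight `1 / (1 + l t²)`. -/
noncomputable def cauchyWeight (l t : ℝ) : ℝ := (1 + l * t ^ 2)⁻¹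

lemma cauchyWeight_pos {l : ℝ} (hl : 0 ≤ l) (t : ℝ) : 0 < cauchyWeight l t := by
  unfold cauchyWeight; positivity

lemma cauchyWeight_le_one {l : ℝ} (hl : 0 ≤ l) (t : ℝ) : cauchyWeight l t ≤ 1 := by
  unfold cauchyWeight
  exact inv_le_one_of_one_le₀ (by nlinarith [mul_nonneg hl (sq_nonneg t)])

lemma measurable_cauchyWeight (l : ℝ) : Measurable (cauchyWeight l) := by
  unfold cauchyWeight; fun_prop

lemma integrable_and_integral_cauchyWeight {l : ℝ} (hl : 0 < l) :
    Integrable (cauchyWeight l) ∧ ∫ t, cauchyWeight l t = Real.pi / √l := by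
  have hs : 0 < √l := Real.sqrt_pos.2 hl
  obtain ⟨h1, h2⟩ := integrable_and_integral_inv_sq_add_sq (inv_pos.2 hs)
  have e : cauchyWeight l = fun t => l⁻¹ * ((√l)⁻¹ ^ 2 + t ^ 2)⁻¹ := by
    funext t
    rw [cauchyWeight, inv_pow, Real.sq_sqrt hl.le, ← mul_inv]
    congr 1
    field_simp
  refine ⟨by rw [e]; exact h1.const_mul _, ?_⟩
  rw [e, integral_const_mul, h2]
  field_simp
  exact Real.sq_sqrt hl.le

lemma hasDerivAt_cauchyWeight {l : ℝ} (hl : 0 ≤ l) (t : ℝ) :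
    HasDerivAt (cauchyWeight l) (-(2 * l * t) / (1 + l * t ^ 2) ^ 2) t ∧
    HasDerivAt (fun t => -(2 * l * t) / (1 + l * t ^ 2) ^ 2)
      (-(2 * l) / (1 + l * t ^ 2) ^ 2 + 8 * l ^ 2 * t ^ 2 / (1 + l * t ^ 2) ^ 3) t := by
  have h0 : 1 + l * t ^ 2 ≠ 0 := by positivity
  have d : HasDerivAt (fun t : ℝ => 1 + l * t ^ 2) (2 * l * t) t := by
    have := (((hasDerivAt_id t).pow 2).const_mul l).const_add 1
    refine this.congr_deriv ?_
    simp; ring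
  refine ⟨d.inv h0, ?_⟩
  have n : HasDerivAt (fun t : ℝ => -(2 * l * t)) (-(2 * l)) t := by
    exact ((hasDerivAt_id t).const_mul (2 * l)).neg.congr_deriv (by simp)
  refine (n.div (d.pow 2) (pow_ne_zero 2 h0)).congr_deriv ?_
  simp
  field_simp
  ring

/-- The weight is a function of `u = l t²`, and the scale-invariant operators `t ∂_t`, `t² ∂_t²` do
not see `l`; the constant is therefore uniform in `l`. -/
lemma symbolBound_cauchyWeight {l : ℝ} (hl : 0 ≤ l) :
    SymbolBound (fun t => (cauchyWeight l t : ℂ)) (fun t => 10 * cauchyWeight l t) := by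
  refine SymbolBound.ofReal
    (g₁ := fun t => -(2 * l * t) / (1 + l * t ^ 2) ^ 2)
    (g₂ := fun t => -(2 * l) / (1 + l * t ^ 2) ^ 2 + 8 * l ^ 2 * t ^ 2 / (1 + l * t ^ 2) ^ 3)
    fun t _ => ?_
  obtain ⟨d1, d2⟩ := hasDerivAt_cauchyWeight hl t
  refine ⟨d1, d2, ?_, ?_, ?_⟩
  · rw [abs_of_pos (cauchyWeight_pos hl t)]; linarith [cauchyWeight_pos hl t]
  · have : t * (-(2 * l * t) / (1 + l * t ^ 2) ^ 2) = -(2 * (l * t ^ 2)) / (1 + l * t ^ 2) ^ 2 := by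
      ring
    rw [this, cauchyWeight]
    have hu : 0 ≤ l * t ^ 2 := by positivity
    generalize l * t ^ 2 = u at hu
    rw [abs_div, abs_neg, abs_of_nonneg (by positivity), abs_of_nonneg (by positivity),
      ← div_eq_mul_inv, div_le_div_iff₀ (by positivity) (by positivity)]
    nlinarith
  · have : t ^ 2 * (-(2 * l) / (1 + l * t ^ 2) ^ 2 + 8 * l ^ 2 * t ^ 2 / (1 + l * t ^ 2) ^ 3)
        = -(2 * (l * t ^ 2)) / (1 + l * t ^ 2) ^ 2
          + 8 * (l * t ^ 2) ^ 2 / (1 + l * t ^ 2) ^ 3 := by ring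
    rw [this, cauchyWeight]
    have hu : 0 ≤ l * t ^ 2 := by positivity
    generalize l * t ^ 2 = u at hu
    refine (abs_add_le _ _).trans ?_
    rw [abs_div, abs_neg, abs_of_nonneg (by positivity), abs_of_nonneg (by positivity),
      abs_of_nonneg (by positivity)]
    have e : 10 * (1 + u)⁻¹ - (2 * u / (1 + u) ^ 2 + 8 * u ^ 2 / (1 + u) ^ 3)
        = (10 + 18 * u) / (1 + u) ^ 3 := by field_simp; ring
    have : 0 ≤ (10 + 18 * u) / (1 + u) ^ 3 := by positivity
    linarith

/-- The majorant is a multiple of the function itself, not a constant: this retains the second-order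
vanishing at `t = 0` needed for integrating by parts in `ξ`. -/
lemma symbolBound_one_sub_cauchyWeight {l : ℝ} (hl : 0 ≤ l) :
    SymbolBound (fun t => ((1 - cauchyWeight l t : ℝ) : ℂ))
      (fun t => 10 * (1 - cauchyWeight l t)) := by
  refine SymbolBound.ofReal
    (g₁ := fun t => -(-(2 * l * t) / (1 + l * t ^ 2) ^ 2))
    (g₂ := fun t => -(-(2 * l) / (1 + l * t ^ 2) ^ 2 + 8 * l ^ 2 * t ^ 2 / (1 + l * t ^ 2) ^ 3))
    fun t _ => ?_
  obtain ⟨d1, d2⟩ := hasDerivAt_cauchyWeight hl t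
  refine ⟨d1.const_sub 1, d2.neg, ?_, ?_, ?_⟩
  · have := cauchyWeight_le_one hl t
    rw [abs_of_nonneg (by linarith)]; linarith
  · have : t * -(-(2 * l * t) / (1 + l * t ^ 2) ^ 2) = 2 * (l * t ^ 2) / (1 + l * t ^ 2) ^ 2 := by
      ring
    rw [this, cauchyWeight]
    have hu : 0 ≤ l * t ^ 2 := by positivity
    generalize l * t ^ 2 = u at hu
    rw [abs_of_nonneg (by positivity)]
    have e : 10 * (1 - (1 + u)⁻¹) - 2 * u / (1 + u) ^ 2 = (8 * u + 10 * u ^ 2) / (1 + u) ^ 2 := by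
      field_simp; ring
    have : 0 ≤ (8 * u + 10 * u ^ 2) / (1 + u) ^ 2 := by positivity
    linarith
  · have : t ^ 2 * -(-(2 * l) / (1 + l * t ^ 2) ^ 2 + 8 * l ^ 2 * t ^ 2 / (1 + l * t ^ 2) ^ 3)
        = 2 * (l * t ^ 2) / (1 + l * t ^ 2) ^ 2
          + -(8 * (l * t ^ 2) ^ 2 / (1 + l * t ^ 2) ^ 3) := by ring
    rw [this, cauchyWeight]
    have hu : 0 ≤ l * t ^ 2 := by positivity
    generalize l * t ^ 2 = u at hu
    refine (abs_add_le _ _).trans ?_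
    rw [abs_neg, abs_of_nonneg (by positivity), abs_of_nonneg (by positivity)]
    have e : 10 * (1 - (1 + u)⁻¹) - (2 * u / (1 + u) ^ 2 + 8 * u ^ 2 / (1 + u) ^ 3)
        = (8 * u + 10 * u ^ 2 + 10 * u ^ 3) / (1 + u) ^ 3 := by field_simp; ring
    have : 0 ≤ (8 * u + 10 * u ^ 2 + 10 * u ^ 3) / (1 + u) ^ 3 := by positivity
    linarith

/-! ### Gaussian localisation to a scale -/

/-- The localisation `x exp (-s x² / 2)` to the scale `|x| ∼ s ^ (-1/2)`. -/
noncomputable def bumpScale (s x : ℝ) : ℝ := x * Real.exp (-(s * x ^ 2) / 2)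

lemma bumpScale_sq (s x : ℝ) : bumpScale s x ^ 2 = x ^ 2 * Real.exp (-(s * x ^ 2)) := by
  rw [bumpScale, mul_pow, ← Real.exp_nat_mul]; congr 2; push_cast; ring

/-- The polynomial majorises those appearing in `a_s²` and its first two scaled derivatives, with `u
= s x²`. The decay comes from `(1 + u/4)^4 ≤ e^u`, and `1024 = 64 * 16`. -/
lemma poly_mul_exp_neg_le {u : ℝ} (hu : 0 ≤ u) :
    (2 + 10 * u + 4 * u ^ 2) * Real.exp (-u) ≤ 1024 * ((1 + u)⁻¹) ^ 2 := by
  have h1 : (1 + u / 4) ^ 4 ≤ Real.exp u := by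
    calc (1 + u / 4) ^ 4 ≤ Real.exp (u / 4) ^ 4 := by
          gcongr; linarith [Real.add_one_le_exp (u / 4)]
      _ = Real.exp u := by rw [← Real.exp_nat_mul]; congr 1; push_cast; ring
  rw [Real.exp_neg, ← div_eq_mul_inv, inv_pow, ← div_eq_mul_inv,
    div_le_div_iff₀ (Real.exp_pos _) (by positivity)]
  calc (2 + 10 * u + 4 * u ^ 2) * (1 + u) ^ 2
      ≤ (64 * (1 + u / 4) ^ 2) * (16 * (1 + u / 4) ^ 2) := by
        gcongr <;> nlinarith
    _ = 1024 * (1 + u / 4) ^ 4 := by ring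
    _ ≤ _ := by gcongr

lemma bumpScale_sq_le {s : ℝ} (hs : 0 < s) (x : ℝ) : bumpScale s x ^ 2 ≤ s⁻¹ := by
  rw [bumpScale_sq, Real.exp_neg, ← div_eq_mul_inv, div_le_iff₀ (Real.exp_pos _),
    inv_mul_eq_div, le_div_iff₀ hs]
  linarith [Real.add_one_le_exp (s * x ^ 2)]

/-- The majorant keeps `x²`, for the vanishing at the origin, and two Cauchy factors: one offsets
the growth of `x²`, the other gives integrability. -/
lemma symbolBound_bumpScale_sq {s : ℝ} (hs : 0 < s) :
    SymbolBound (fun x => ((bumpScale s x ^ 2 : ℝ) : ℂ))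
      (fun x => 1024 * (x ^ 2 * cauchyWeight s x ^ 2)) := by
  have hE : ∀ x : ℝ, HasDerivAt (fun x : ℝ => Real.exp (-(s * x ^ 2)))
      (-(2 * s * x) * Real.exp (-(s * x ^ 2))) x := fun x => by
    have := ((((hasDerivAt_id x).pow 2).const_mul s).neg).exp
    refine this.congr_deriv ?_
    simp; ring
  refine SymbolBound.ofReal (g₁ := fun x => (2 * x - 2 * s * x ^ 3) * Real.exp (-(s * x ^ 2)))
    (g₂ := fun x => (2 - 10 * s * x ^ 2 + 4 * s ^ 2 * x ^ 4) * Real.exp (-(s * x ^ 2)))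
    fun x _ => ?_
  have hu : 0 ≤ s * x ^ 2 := by positivity
  have key := poly_mul_exp_neg_le hu
  have key' : x ^ 2 * ((2 + 10 * (s * x ^ 2) + 4 * (s * x ^ 2) ^ 2) * Real.exp (-(s * x ^ 2)))
      ≤ 1024 * (x ^ 2 * cauchyWeight s x ^ 2) := by
    rw [cauchyWeight, mul_left_comm (1024 : ℝ)]
    exact mul_le_mul_of_nonneg_left key (sq_nonneg x)
  have hpos := Real.exp_pos (-(s * x ^ 2))
  refine ⟨?_, ?_, ?_, ?_, ?_⟩
  · have : (fun x => bumpScale s x ^ 2) = fun x => x ^ 2 * Real.exp (-(s * x ^ 2)) :=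
      funext fun x => bumpScale_sq s x
    rw [this]
    refine ((hasDerivAt_pow 2 x).mul (hE x)).congr_deriv ?_
    simp; ring
  · have d : HasDerivAt (fun x : ℝ => 2 * x - 2 * s * x ^ 3) (2 - 6 * s * x ^ 2) x := by
      refine (((hasDerivAt_id x).const_mul 2).sub
        ((hasDerivAt_pow 3 x).const_mul (2 * s))).congr_deriv ?_
      simp; ring
    refine (d.mul (hE x)).congr_deriv ?_
    ring
  · refine le_trans ?_ key'
    rw [bumpScale_sq, abs_of_nonneg (by positivity)]
    gcongr
    refine le_mul_of_one_le_left hpos.le (by nlinarith)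
  · refine le_trans ?_ key'
    have : x * ((2 * x - 2 * s * x ^ 3) * Real.exp (-(s * x ^ 2)))
        = x ^ 2 * ((2 - 2 * (s * x ^ 2)) * Real.exp (-(s * x ^ 2))) := by ring
    rw [this, abs_mul, abs_mul, abs_of_nonneg (sq_nonneg x), abs_of_pos hpos]
    gcongr
    rw [abs_le]; constructor <;> nlinarith
  · refine le_trans ?_ key'
    have : 2 - 10 * s * x ^ 2 + 4 * s ^ 2 * x ^ 4
        = 2 - 10 * (s * x ^ 2) + 4 * (s * x ^ 2) ^ 2 := by ring
    rw [this, abs_mul, abs_mul, abs_of_nonneg (sq_nonneg x), abs_of_pos hpos]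
    gcongr
    rw [abs_le]; constructor <;> nlinarith

/-! ### Pointwise estimates for the two Gram kernels -/

/-- A measurable symbol with homogeneous bounds of order two in each variable separately. -/
structure IsBiSymbol (m : ℝ → ℝ → ℂ) (D : ℝ) : Prop where
  measurable : Measurable (uncurry m)
  norm_le : ∀ x ξ, ‖m x ξ‖ ≤ D
  left : ∀ ξ, SymbolBound (fun x => m x ξ) (fun _ => D)
  right : ∀ x, SymbolBound (fun ξ => m x ξ) (fun _ => D)

/-- The oscillatory kernel with amplitude `m`. -/
noncomputable def oscKernel (m : ℝ → ℝ → ℂ) (x ξ : ℝ) : ℂ :=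
  Complex.exp (Complex.I * x * ξ) * m x ξ

lemma norm_oscKernel (m : ℝ → ℝ → ℂ) (x ξ : ℝ) : ‖oscKernel m x ξ‖ = ‖m x ξ‖ := by
  rw [oscKernel, norm_mul, show Complex.I * x * ξ = ((x * ξ : ℝ) : ℂ) * Complex.I by
    push_cast; ring, Complex.norm_exp_ofReal_mul_I, one_mul]

lemma measurable_oscKernel {m : ℝ → ℝ → ℂ} (hm : Measurable (uncurry m)) :
    Measurable (uncurry (oscKernel m)) :=
  (by fun_prop : Measurable fun z : ℝ × ℝ => Complex.exp (Complex.I * z.1 * z.2)).mul hm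

lemma conj_oscKernel_mul (m : ℝ → ℝ → ℂ) (x y ξ η : ℝ) :
    conj (oscKernel m x ξ) * oscKernel m y η
      = Complex.exp (Complex.I * ((y * η - x * ξ : ℝ) : ℂ)) * (conj (m x ξ) * m y η) := by
  rw [oscKernel, oscKernel, map_mul, ← Complex.exp_conj]
  simp only [map_mul, Complex.conj_I, Complex.conj_ofReal]
  rw [mul_mul_mul_comm, ← Complex.exp_add]
  congr 2
  push_cast; ring

/-- The kernel of `T a² T*` decays like a Cauchy kernel at scale `s ^ (1/2)`. -/
lemma norm_gramKernel_bumpScale_le {m : ℝ → ℝ → ℂ} {D : ℝ} (hm : IsBiSymbol m D) {s : ℝ}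
    (hs : 0 < s) (ξ η : ℝ) :
    ‖gramKernel (fun ξ x => oscKernel m x ξ) (fun x => bumpScale s x ^ 2) ξ η‖
      ≤ 32768 * D ^ 2 * Real.pi / √s * ((√s) ^ 2 + (η - ξ) ^ 2)⁻¹ := by
  -- `16384 = 4 * 1024 * 4`: two product rules and the constant of the Gaussian bump.
  set c := 16384 * D ^ 2 with hc
  have hc0 : 0 ≤ c := by positivity
  set b : ℝ → ℝ := fun x => c * (x ^ 2 * cauchyWeight s x ^ 2) with hb
  obtain ⟨hwi, hwI⟩ := integrable_and_integral_cauchyWeight hs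
  have hw0 := cauchyWeight_pos hs.le
  have hw1 := cauchyWeight_le_one hs.le
  have hwm := measurable_cauchyWeight s
  have hG : SymbolBound (fun x => ((bumpScale s x ^ 2 : ℝ) : ℂ) * (conj (m x ξ) * m x η)) b := by
    refine ((symbolBound_bumpScale_sq hs).mul ((hm.left ξ).conj.mul (hm.left η))).mono
      fun x _ => le_of_eq ?_
    simp only [hb, hc]; ring
  have hxw : ∀ x, x ^ 2 * cauchyWeight s x ≤ s⁻¹ := fun x => by
    rw [cauchyWeight, ← div_eq_mul_inv, inv_eq_one_div, div_le_div_iff₀ (by positivity) hs]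
    nlinarith
  have hb1 : ∀ x, b x ≤ c / s * cauchyWeight s x := fun x => by
    calc b x = c * (x ^ 2 * cauchyWeight s x) * cauchyWeight s x := by simp only [hb]; ring
      _ ≤ c * s⁻¹ * cauchyWeight s x := by
          gcongr
          · exact (hw0 x).le
          · exact hxw x
  have hb0 : ∀ x, 0 ≤ b x := fun x => by simp only [hb]; positivity
  have hbm : Measurable b := by simp only [hb]; fun_prop
  have hbi : Integrable b := (hwi.const_mul (c / s)).mono' hbm.aestronglyMeasurable
    (ae_of_all _ fun x => by rw [Real.norm_of_nonneg (hb0 x)]; exact hb1 x)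
  have hb2 : ∀ x, b x / x ^ 2 ≤ c * cauchyWeight s x := fun x => by
    refine div_le_of_le_mul₀ (sq_nonneg x) (mul_nonneg hc0 (hw0 x).le) ?_
    calc b x = c * cauchyWeight s x * x ^ 2 * cauchyWeight s x := by simp only [hb]; ring
      _ ≤ _ := mul_le_of_le_one_right (by have := (hw0 x).le; positivity) (hw1 x)
  have hbi2 : Integrable (fun x => b x / x ^ 2) := (hwi.const_mul c).mono'
    (hbm.div (by fun_prop)).aestronglyMeasurable
    (ae_of_all _ fun x => by
      rw [Real.norm_of_nonneg (div_nonneg (hb0 x) (sq_nonneg x))]; exact hb2 x)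
  have hL : gramKernel (fun ξ x => oscKernel m x ξ) (fun x => bumpScale s x ^ 2) ξ η
      = ∫ x : ℝ, Complex.exp (Complex.I * ((η - ξ : ℝ) : ℂ) * x)
        * (((bumpScale s x ^ 2 : ℝ) : ℂ) * (conj (m x ξ) * m x η)) := by
    rw [gramKernel]
    refine integral_congr_ae (ae_of_all _ fun x => ?_)
    dsimp only
    rw [conj_oscKernel_mul, mul_left_comm]
    congr 2
    push_cast; ring
  -- The size bound, useful for `|η - ξ| ≤ √s`. Added to the oscillatory bound `b2`, it yields the
  -- Cauchy profile.
  have b1 : ‖gramKernel (fun ξ x => oscKernel m x ξ) (fun x => bumpScale s x ^ 2) ξ η‖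
      ≤ c / s * (Real.pi / √s) := by
    rw [← hwI, ← integral_const_mul, hL]
    refine norm_integral_le_of_norm_le (hwi.const_mul _) ?_
    obtain ⟨_, _, H⟩ := hG
    filter_upwards [ae_ne_zero_real] with x hx
    rw [norm_mul, show Complex.I * ((η - ξ : ℝ) : ℂ) * x
      = (((η - ξ) * x : ℝ) : ℂ) * Complex.I by push_cast; ring,
      Complex.norm_exp_ofReal_mul_I, one_mul]
    exact (H x hx).2.2.1.trans (hb1 x)
  have b2 : (η - ξ) ^ 2 *
      ‖gramKernel (fun ξ x => oscKernel m x ξ) (fun x => bumpScale s x ^ 2) ξ η‖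
      ≤ c * (Real.pi / √s) := by
    rw [← hwI, ← integral_const_mul, hL]
    refine (hG.sq_mul_norm_integral_le hbi hbi2 (c := c) (fun x _ => ?_) _).trans
      (integral_mono hbi2 (hwi.const_mul _) hb2)
    simp only [hb]
    gcongr
    exact mul_le_of_le_one_right (sq_nonneg x) (pow_le_one₀ (hw0 x).le (hw1 x))
  have hss : 0 < √s := Real.sqrt_pos.2 hs
  rw [← div_eq_mul_inv, le_div_iff₀ (by positivity), Real.sq_sqrt hs.le]
  have b1' : s * ‖gramKernel (fun ξ x => oscKernel m x ξ) (fun x => bumpScale s x ^ 2) ξ η‖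
      ≤ c * (Real.pi / √s) := by
    calc _ ≤ s * (c / s * (Real.pi / √s)) := by gcongr
      _ = _ := by field_simp
  calc _ = s * ‖gramKernel (fun ξ x => oscKernel m x ξ) (fun x => bumpScale s x ^ 2) ξ η‖
        + (η - ξ) ^ 2 * ‖gramKernel (fun ξ x => oscKernel m x ξ)
          (fun x => bumpScale s x ^ 2) ξ η‖ := by ring
    _ ≤ c * (Real.pi / √s) + c * (Real.pi / √s) := add_le_add b1' b2
    _ = _ := by rw [hc]; ring

/-- The part of the amplitude living on `|x ξ| ≳ 1`. -/
noncomputable def highPart (m : ℝ → ℝ → ℂ) (x ξ : ℝ) : ℂ :=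
  m x ξ * ((1 - cauchyWeight (x ^ 2) ξ : ℝ) : ℂ)

lemma integrable_and_integral_sq_mul_cauchyWeight (x : ℝ) :
    Integrable (fun t => x ^ 2 * cauchyWeight (x ^ 2) t) ∧
      ∫ t, x ^ 2 * cauchyWeight (x ^ 2) t = Real.pi * |x| := by
  rcases eq_or_ne x 0 with rfl | hx
  · simp
  · obtain ⟨h1, h2⟩ := integrable_and_integral_cauchyWeight (l := x ^ 2) (by positivity)
    refine ⟨h1.const_mul _, ?_⟩
    rw [integral_const_mul, h2, Real.sqrt_sq_eq_abs, ← sq_abs]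
    have : |x| ≠ 0 := abs_ne_zero.2 hx
    field_simp

/-- Off-diagonal decay of the kernel of `S* w S`. -/
lemma sq_mul_norm_gramKernel_highPart_le {m : ℝ → ℝ → ℂ} {D : ℝ} (hm : IsBiSymbol m D) {l : ℝ}
    (hl : 0 < l) (x y : ℝ) :
    (y - x) ^ 2 * ‖gramKernel (oscKernel (highPart m)) (cauchyWeight l) x y‖
      ≤ 256000 * D ^ 2 * Real.pi * √(|x| * |y|) := by
  -- `256000 = 4 * 10 * (4 * 40 * 40)`: product rules applied to the weight and to two copies of the
  -- high part, each bounded by `40 D φ`.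
  set c := 256000 * D ^ 2 with hc
  have hc0 : 0 ≤ c := by positivity
  set φ : ℝ → ℝ → ℝ := fun x t => 1 - cauchyWeight (x ^ 2) t with hφ
  have hφ0 : ∀ x t, 0 ≤ φ x t := fun x t => sub_nonneg.2 (cauchyWeight_le_one (sq_nonneg x) t)
  have hφ1 : ∀ x t, φ x t ≤ 1 := fun x t =>
    sub_le_self _ (cauchyWeight_pos (sq_nonneg x) t).le
  -- The explicit factor `t²` is what makes `b t / t²` integrable at the origin, with total mass
  -- proportional to `|x|`.
  have hφe : ∀ x t, φ x t = t ^ 2 * (x ^ 2 * cauchyWeight (x ^ 2) t) := fun x t => by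
    simp only [hφ, cauchyWeight]; field_simp; ring
  have hφm : ∀ x, Measurable (φ x) := fun x => (measurable_cauchyWeight _).const_sub 1
  set b : ℝ → ℝ := fun t => c * (cauchyWeight l t * (φ x t * φ y t)) with hb
  obtain ⟨hwi, -⟩ := integrable_and_integral_cauchyWeight hl
  have hw0 := cauchyWeight_pos hl.le
  have hw1 := cauchyWeight_le_one hl.le
  have hwm := measurable_cauchyWeight l
  have hS : ∀ x, SymbolBound (highPart m x) (fun t => 40 * D * φ x t) := fun x =>
    ((hm.right x).mul (symbolBound_one_sub_cauchyWeight (sq_nonneg x))).mono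
      fun t _ => le_of_eq (by simp only [hφ]; ring)
  have hG : SymbolBound (fun t => (cauchyWeight l t : ℂ) *
      (conj (highPart m x t) * highPart m y t)) b :=
    ((symbolBound_cauchyWeight hl.le).mul ((hS x).conj.mul (hS y))).mono
      fun t _ => le_of_eq (by simp only [hb, hc]; ring)
  have hb0 : ∀ t, 0 ≤ b t := fun t =>
    mul_nonneg hc0 (mul_nonneg (hw0 t).le (mul_nonneg (hφ0 _ _) (hφ0 _ _)))
  have hbm : Measurable b := by
    have := hφm x; have := hφm y; simp only [hb]; fun_prop
  have hbi : Integrable b := (hwi.const_mul c).mono' hbm.aestronglyMeasurable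
    (ae_of_all _ fun t => by
      rw [Real.norm_of_nonneg (hb0 t)]
      exact mul_le_mul_of_nonneg_left (mul_le_of_le_one_right (hw0 t).le
        (mul_le_one₀ (hφ1 _ _) (hφ0 _ _) (hφ1 _ _))) hc0)
  have hbx : ∀ t, b t ≤ c * φ x t := fun t => mul_le_mul_of_nonneg_left
    ((mul_le_of_le_one_left (mul_nonneg (hφ0 _ _) (hφ0 _ _)) (hw1 t)).trans
      (mul_le_of_le_one_right (hφ0 _ _) (hφ1 _ _))) hc0
  have hby : ∀ t, b t ≤ c * φ y t := fun t => mul_le_mul_of_nonneg_left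
    ((mul_le_of_le_one_left (mul_nonneg (hφ0 _ _) (hφ0 _ _)) (hw1 t)).trans
      (mul_le_of_le_one_left (hφ0 _ _) (hφ1 _ _))) hc0
  have hdiv : ∀ z, (∀ t, b t ≤ c * φ z t) →
      ∀ t, b t / t ^ 2 ≤ c * (z ^ 2 * cauchyWeight (z ^ 2) t) := fun z hz t => by
    have := (cauchyWeight_pos (sq_nonneg z) t).le
    refine div_le_of_le_mul₀ (sq_nonneg t) (by positivity) ((hz t).trans (le_of_eq ?_))
    rw [hφe]; ring
  have hbi2 : Integrable (fun t => b t / t ^ 2) :=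
    ((integrable_and_integral_sq_mul_cauchyWeight x).1.const_mul c).mono'
    (hbm.div (by fun_prop)).aestronglyMeasurable
    (ae_of_all _ fun t => by
      rw [Real.norm_of_nonneg (div_nonneg (hb0 t) (sq_nonneg t))]; exact hdiv x hbx t)
  have hL : gramKernel (oscKernel (highPart m)) (cauchyWeight l) x y
      = ∫ t : ℝ, Complex.exp (Complex.I * ((y - x : ℝ) : ℂ) * t)
        * ((cauchyWeight l t : ℂ) * (conj (highPart m x t) * highPart m y t)) := by
    rw [gramKernel]
    refine integral_congr_ae (ae_of_all _ fun t => ?_)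
    dsimp only
    rw [conj_oscKernel_mul, mul_left_comm]
    congr 2
    push_cast; ring
  have main : (y - x) ^ 2 * ‖gramKernel (oscKernel (highPart m)) (cauchyWeight l) x y‖
      ≤ ∫ t, b t / t ^ 2 := by
    rw [hL]
    refine hG.sq_mul_norm_integral_le hbi hbi2 (c := c * x ^ 2) (fun t _ => ?_) _
    refine (hbx t).trans ?_
    calc c * φ x t = c * (x ^ 2 * cauchyWeight (x ^ 2) t) * t ^ 2 := by rw [hφe]; ring
      _ ≤ c * x ^ 2 * t ^ 2 := by
          gcongr
          exact mul_le_of_le_one_right (sq_nonneg x) (cauchyWeight_le_one (sq_nonneg x) t)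
  have hz : ∀ z, (∀ t, b t ≤ c * φ z t) → ∫ t, b t / t ^ 2 ≤ c * Real.pi * |z| := fun z hz => by
    obtain ⟨i1, i2⟩ := integrable_and_integral_sq_mul_cauchyWeight z
    rw [mul_assoc, ← i2, ← integral_const_mul]
    exact integral_mono hbi2 (i1.const_mul c) (hdiv z hz)
  refine main.trans ?_
  have hI0 : 0 ≤ ∫ t, b t / t ^ 2 := integral_nonneg fun t => div_nonneg (hb0 t) (sq_nonneg t)
  -- The integral is bounded by `cπ|x|` and by `cπ|y|`, hence by their geometric mean, which is
  -- symmetric and suited to Schur's test.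
  refine abs_le_of_sq_le_sq' ?_ (by positivity) |>.2
  rw [mul_pow, Real.sq_sqrt (by positivity), sq]
  calc _ ≤ (c * Real.pi * |x|) * (c * Real.pi * |y|) :=
        mul_le_mul (hz x hbx) (hz y hby) hI0 (by positivity)
    _ = _ := by ring

/-! ### `L²` bounds for the low part and for a single scale -/

lemma enorm_sq_le_two_mul (a b : ℂ) : ‖a‖ₑ ^ 2 ≤ 2 * ‖b‖ₑ ^ 2 + 2 * ‖a - b‖ₑ ^ 2 := by
  simp only [enorm_eq_nnnorm]
  norm_cast
  have h : ‖a‖₊ ≤ ‖b‖₊ + ‖a - b‖₊ := by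
    simpa using nnnorm_add_le b (a - b)
  calc ‖a‖₊ ^ 2 ≤ (‖b‖₊ + ‖a - b‖₊) ^ 2 := by gcongr
    _ ≤ 2 * (‖b‖₊ ^ 2 + ‖a - b‖₊ ^ 2) := add_sq_le
    _ = _ := by ring

section

variable {m : ℝ → ℝ → ℂ} {D : ℝ≥0} {f : ℝ → ℂ}

lemma measurable_highPart (hm : Measurable (uncurry m)) : Measurable (uncurry (highPart m)) := by
  refine Measurable.mul hm ?_
  simp only [cauchyWeight]
  fun_prop

lemma norm_highPart_le (hm : IsBiSymbol m D) (x ξ : ℝ) : ‖highPart m x ξ‖ ≤ D := by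
  rw [highPart, norm_mul, Complex.norm_real, Real.norm_of_nonneg
    (sub_nonneg.2 (cauchyWeight_le_one (sq_nonneg x) ξ))]
  refine (mul_le_of_le_one_right (norm_nonneg _) ?_).trans (hm.norm_le x ξ)
  linarith [(cauchyWeight_pos (sq_nonneg x) ξ).le]

/-- The difference of the two kernels is the full kernel times `1 / (1 + (xξ)²)`, so absolute values
suffice and `lintegral_hardy` applies. -/
lemma lintegral_lowPart_sq_le (hm : IsBiSymbol m D) (hfm : Measurable f) (hf : Integrable f) :
    ∫⁻ ξ, ‖kernelOp (oscKernel m) f ξ - kernelOp (oscKernel (highPart m)) f ξ‖ₑ ^ 2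
      ≤ 2 * hardyConst ^ 2 * D ^ 2 * ∫⁻ x, ‖f x‖ₑ ^ 2 := by
  calc ∫⁻ ξ, ‖kernelOp (oscKernel m) f ξ - kernelOp (oscKernel (highPart m)) f ξ‖ₑ ^ 2
      ≤ ∫⁻ ξ : ℝ, (∫⁻ x : ℝ, ENNReal.ofReal (1 + (ξ * x) ^ 2)⁻¹ * (D * ‖f x‖₊ : ℝ≥0)) ^ 2 := by
        refine lintegral_mono fun ξ => ?_
        gcongr
        rw [kernelOp, kernelOp, ← integral_sub
          (integrable_kernel_mul (measurable_oscKernel hm.measurable)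
            (fun x ξ => (norm_oscKernel m x ξ).trans_le (hm.norm_le x ξ)) hf ξ)
          (integrable_kernel_mul (measurable_oscKernel (measurable_highPart hm.measurable))
            (fun x ξ => (norm_oscKernel _ x ξ).trans_le (norm_highPart_le hm x ξ)) hf ξ)]
        refine (enorm_integral_le_lintegral_enorm _).trans (lintegral_mono fun x => ?_)
        have e : oscKernel m x ξ * f x - oscKernel (highPart m) x ξ * f x
            = ((cauchyWeight (x ^ 2) ξ : ℝ) : ℂ) * (oscKernel m x ξ * f x) := by
          simp only [oscKernel, highPart]; push_cast; ring
        have e2 : cauchyWeight (x ^ 2) ξ = (1 + (ξ * x) ^ 2)⁻¹ := by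
          rw [cauchyWeight]; ring
        rw [e, enorm_mul, ← ofReal_norm ((cauchyWeight (x ^ 2) ξ : ℝ) : ℂ), Complex.norm_real,
          Real.norm_of_nonneg (cauchyWeight_pos (sq_nonneg x) ξ).le, e2]
        gcongr
        rw [enorm_mul, ENNReal.coe_mul, enorm_eq_nnnorm, enorm_eq_nnnorm]
        gcongr
        exact (norm_oscKernel m x ξ).trans_le (hm.norm_le x ξ)
    _ ≤ 2 * hardyConst ^ 2 * ∫⁻ x, ((D * ‖f x‖₊ : ℝ≥0) : ℝ≥0∞) ^ 2 :=
        lintegral_hardy (by fun_prop)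
    _ = _ := by
        simp only [ENNReal.coe_mul, mul_pow, ← enorm_eq_nnnorm]
        rw [lintegral_const_mul _ (by fun_prop)]
        ring

lemma measurable_bumpScale (s : ℝ) : Measurable (bumpScale s) := by
  unfold bumpScale; fun_prop

lemma integrable_bumpScale_sq {s : ℝ} (hs : 0 < s) : Integrable (fun x => bumpScale s x ^ 2) := by
  obtain ⟨hi, -⟩ := integrable_and_integral_cauchyWeight hs
  obtain ⟨_, _, H⟩ := symbolBound_bumpScale_sq hs
  refine (hi.const_mul (1024 * s⁻¹)).mono'
    ((measurable_bumpScale s).pow_const 2).aestronglyMeasurable ?_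
  filter_upwards [ae_ne_zero_real] with x hx
  have h1 := (H x hx).2.2.1
  rw [Complex.norm_real] at h1
  refine h1.trans ?_
  have h0 := (cauchyWeight_pos hs.le x).le
  have : x ^ 2 * cauchyWeight s x ≤ s⁻¹ := by
    rw [cauchyWeight, ← div_eq_mul_inv, inv_eq_one_div, div_le_div_iff₀ (by positivity) hs]
    nlinarith
  calc _ = 1024 * (x ^ 2 * cauchyWeight s x) * cauchyWeight s x := by ring
    _ ≤ _ := by gcongr

lemma abs_bumpScale_le {s : ℝ} (hs : 0 < s) (x : ℝ) : |bumpScale s x| ≤ √s⁻¹ :=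
  Real.abs_le_sqrt (bumpScale_sq_le hs x)

/-- The `T T*` argument with a Cauchy kernel of height parameter `A ∼ D² s^(-1/2)`, whose mass
`Aπ/√s` is of order `D²/s`. The weight with parameter `l` does not affect the constant. -/
lemma lintegral_weight_bumpScale_le (hm : IsBiSymbol m D) (hD : 0 < D) (hfm : Measurable f)
    (hf : Integrable f) {l s : ℝ} (hl : 0 < l) (hs : 0 < s) :
    ∫⁻ ξ, ENNReal.ofReal (cauchyWeight l ξ) *
        ‖kernelOp (oscKernel m) (fun x => bumpScale s x * f x) ξ‖ₑ ^ 2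
      ≤ ENNReal.ofReal (65536 * Real.pi ^ 2 * D ^ 2 / s) * ∫⁻ x, ‖f x‖ₑ ^ 2 := by
  have hss : 0 < √s := Real.sqrt_pos.2 hs
  have hD' : (0:ℝ) < D := hD
  set A : ℝ := 32768 * (D:ℝ) ^ 2 * Real.pi / √s with hA
  have hA0 : 0 < A := by positivity
  set N : ℝ → ℝ → ℝ≥0∞ := fun ξ η => ENNReal.ofReal (A * ((√s) ^ 2 + (η - ξ) ^ 2)⁻¹) with hN
  have hM0 : 0 < A * (Real.pi / √s) := by positivity
  have key := lintegral_weight_kernelOp_sq_le_of_adjoint (k := oscKernel m)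
    (v := cauchyWeight l) (a := bumpScale s) (N := N) (M := (A * (Real.pi / √s)).toNNReal)
    (measurable_oscKernel hm.measurable)
    (fun x ξ => (norm_oscKernel m x ξ).trans_le (hm.norm_le x ξ))
    (integrable_and_integral_cauchyWeight hl).1 (fun ξ => (cauchyWeight_pos hl.le ξ).le)
    (cauchyWeight_le_one hl.le) (measurable_cauchyWeight l) (measurable_bumpScale s)
    (abs_bumpScale_le hs) (integrable_bumpScale_sq hs) (by simp only [hN, uncurry_def]; fun_prop)
    (fun ξ η => by simp only [hN]; rw [← neg_sub, neg_sq])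
    (fun ξ η => by
      rw [← ofReal_norm]
      exact ENNReal.ofReal_le_ofReal (norm_gramKernel_bumpScale_le hm hs ξ η))
    (Real.toNNReal_pos.2 hM0)
    (fun ξ => by
      simp only [hN, ENNReal.ofReal_mul hA0.le]
      rw [lintegral_const_mul _ (by fun_prop),
        lintegral_sub_right_eq_self (fun η => ENNReal.ofReal ((√s) ^ 2 + η ^ 2)⁻¹) ξ,
        lintegral_inv_sq_add_sq hss, ← ENNReal.ofReal_mul hA0.le]; rfl)
    hfm hf
  refine key.trans (le_of_eq ?_)
  congr 1
  have e : 65536 * Real.pi ^ 2 * (D:ℝ) ^ 2 / s = 2 * (A * (Real.pi / √s)) := by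
    rw [hA]
    field_simp
    rw [Real.sq_sqrt hs.le]
    ring
  rw [e, ENNReal.ofReal_mul (by norm_num)]
  simp [ENNReal.ofReal]

/-- Twice the constant `65536 π²` of the `T T*` bound plus twice the low-part constant `2
hardyConst²`. -/
noncomputable def bumpConst : ℝ := 131072 * Real.pi ^ 2 + 4 * hardyConst.toReal ^ 2

lemma bumpConst_pos : 0 < bumpConst := by
  unfold bumpConst; positivity

/-- Regularity in `x` is exploited for the full operator; passing to the high part costs the low
part applied to `a_s f`, which is also of order `1/s` because `a_s² ≤ 1/s`. -/
lemma lintegral_weight_highPart_bumpScale_le (hm : IsBiSymbol m D) (hD : 0 < D)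
    (hfm : Measurable f) (hf : Integrable f) {l s : ℝ} (hl : 0 < l) (hs : 0 < s) :
    ∫⁻ ξ, ENNReal.ofReal (cauchyWeight l ξ) *
        ‖kernelOp (oscKernel (highPart m)) (fun x => bumpScale s x * f x) ξ‖ₑ ^ 2
      ≤ ENNReal.ofReal (bumpConst * D ^ 2 / s) * ∫⁻ x, ‖f x‖ₑ ^ 2 := by
  have hbm := measurable_bumpScale s
  have hgm : Measurable (fun x => (bumpScale s x : ℂ) * f x) := by fun_prop
  have hg : Integrable (fun x => (bumpScale s x : ℂ) * f x) :=
    hf.bdd_mul (by fun_prop) (c := √s⁻¹) (ae_of_all _ fun x => by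
      simpa using abs_bumpScale_le hs x)
  set g := fun x => (bumpScale s x : ℂ) * f x
  have hTm : Measurable (kernelOp (oscKernel m) g) :=
    measurable_kernelOp (measurable_oscKernel hm.measurable) hgm
  have hSm : Measurable (kernelOp (oscKernel (highPart m)) g) :=
    measurable_kernelOp (measurable_oscKernel (measurable_highPart hm.measurable)) hgm
  have hwm := measurable_cauchyWeight l
  have hgn : ∫⁻ x, ‖g x‖ₑ ^ 2 ≤ ENNReal.ofReal s⁻¹ * ∫⁻ x, ‖f x‖ₑ ^ 2 := by
    rw [← lintegral_const_mul _ (by fun_prop)]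
    refine lintegral_mono fun x => ?_
    change ‖(bumpScale s x : ℂ) * f x‖ₑ ^ 2 ≤ _
    rw [enorm_mul, mul_pow]
    gcongr
    rw [← ofReal_norm, Complex.norm_real, ← ENNReal.ofReal_pow (norm_nonneg _)]
    refine ENNReal.ofReal_le_ofReal ?_
    rw [Real.norm_eq_abs, sq_abs]
    exact bumpScale_sq_le hs x
  have hH : hardyConst = ENNReal.ofReal hardyConst.toReal :=
    (ENNReal.ofReal_toReal hardyConst_lt_top.ne).symm
  calc ∫⁻ ξ, ENNReal.ofReal (cauchyWeight l ξ) * ‖kernelOp (oscKernel (highPart m)) g ξ‖ₑ ^ 2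
      ≤ ∫⁻ ξ, (2 * (ENNReal.ofReal (cauchyWeight l ξ) * ‖kernelOp (oscKernel m) g ξ‖ₑ ^ 2)
          + 2 * ‖kernelOp (oscKernel m) g ξ - kernelOp (oscKernel (highPart m)) g ξ‖ₑ ^ 2) := by
        refine lintegral_mono fun ξ => ?_
        have h1 : ENNReal.ofReal (cauchyWeight l ξ) ≤ 1 :=
          ENNReal.ofReal_le_one.2 (cauchyWeight_le_one hl.le ξ)
        have h2 := enorm_sq_le_two_mul (kernelOp (oscKernel (highPart m)) g ξ)
          (kernelOp (oscKernel m) g ξ)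
        rw [← enorm_neg (kernelOp (oscKernel (highPart m)) g ξ - _), neg_sub] at h2
        calc _ ≤ ENNReal.ofReal (cauchyWeight l ξ) * (2 * ‖kernelOp (oscKernel m) g ξ‖ₑ ^ 2
            + 2 * ‖kernelOp (oscKernel m) g ξ - kernelOp (oscKernel (highPart m)) g ξ‖ₑ ^ 2) := by
              gcongr
          _ = 2 * (ENNReal.ofReal (cauchyWeight l ξ) * ‖kernelOp (oscKernel m) g ξ‖ₑ ^ 2)
            + ENNReal.ofReal (cauchyWeight l ξ) * (2 *
              ‖kernelOp (oscKernel m) g ξ - kernelOp (oscKernel (highPart m)) g ξ‖ₑ ^ 2) := by ring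
          _ ≤ _ := by
              exact add_le_add le_rfl (mul_le_of_le_one_left zero_le h1)
    _ = 2 * (∫⁻ ξ, ENNReal.ofReal (cauchyWeight l ξ) * ‖kernelOp (oscKernel m) g ξ‖ₑ ^ 2)
          + 2 * ∫⁻ ξ, ‖kernelOp (oscKernel m) g ξ
            - kernelOp (oscKernel (highPart m)) g ξ‖ₑ ^ 2 := by
        rw [lintegral_add_left (by fun_prop), lintegral_const_mul _ (by fun_prop),
          lintegral_const_mul _ (by fun_prop)]
    _ ≤ 2 * (ENNReal.ofReal (65536 * Real.pi ^ 2 * D ^ 2 / s) * ∫⁻ x, ‖f x‖ₑ ^ 2)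
          + 2 * (2 * hardyConst ^ 2 * D ^ 2 *
            (ENNReal.ofReal s⁻¹ * ∫⁻ x, ‖f x‖ₑ ^ 2)) := by
        gcongr
        · exact lintegral_weight_bumpScale_le hm hD hfm hf hl hs
        · refine (lintegral_lowPart_sq_le hm hgm hg).trans ?_
          gcongr
    _ = _ := by
        have e : bumpConst * (D:ℝ) ^ 2 / s = 2 * (65536 * Real.pi ^ 2 * D ^ 2 / s)
            + 2 * (2 * hardyConst.toReal ^ 2 * D ^ 2 * s⁻¹) := by
          rw [bumpConst]; field_simp; ring
        rw [e, ENNReal.ofReal_add (by positivity) (by positivity), add_mul]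
        congr 1
        · rw [ENNReal.ofReal_mul (by norm_num), ENNReal.ofReal_ofNat]; ring
        · rw [ENNReal.ofReal_mul (by norm_num), ENNReal.ofReal_mul (by positivity),
            ENNReal.ofReal_mul (by positivity), ENNReal.ofReal_mul (by norm_num),
            ENNReal.ofReal_pow (by positivity), ← hH, ENNReal.ofReal_pow (by positivity),
            ENNReal.ofReal_coe_nnreal, ENNReal.ofReal_ofNat]
          ring

/-! ### Superposition over scales -/

/-- The autocorrelation in scale of `bumpScale s x ^ 2`. -/
noncomputable def scaleCorr (x y : ℝ) : ℝ := 4 * x ^ 2 * y ^ 2 / (x ^ 2 + y ^ 2) ^ 2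

/-- A Gamma integral: `∫ s e^(-rs) ds = r⁻²` with `r = x² + y²`. -/
lemma integral_scaleCorr (x y : ℝ) :
    IntegrableOn (fun s => 4 * s * (bumpScale s x ^ 2 * bumpScale s y ^ 2)) (Ioi 0) ∧
    ∫ s in Ioi (0:ℝ), 4 * s * (bumpScale s x ^ 2 * bumpScale s y ^ 2) = scaleCorr x y := by
  have e : ∀ s : ℝ, 4 * s * (bumpScale s x ^ 2 * bumpScale s y ^ 2)
      = 4 * x ^ 2 * y ^ 2 * (s ^ ((2:ℝ) - 1) * Real.exp (-((x ^ 2 + y ^ 2) * s))) := fun s => by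
    rw [bumpScale_sq, bumpScale_sq, show (2:ℝ) - 1 = 1 by norm_num, Real.rpow_one,
      show -((x ^ 2 + y ^ 2) * s) = -(s * x ^ 2) + -(s * y ^ 2) by ring, Real.exp_add]
    ring
  simp_rw [e, scaleCorr]
  rcases eq_or_ne x 0 with rfl | hx
  · simp
  · have hr : 0 < x ^ 2 + y ^ 2 := by positivity
    have hI := Real.integral_rpow_mul_exp_neg_mul_Ioi (a := 2) (by norm_num) hr
    have hv : (1 / (x ^ 2 + y ^ 2)) ^ (2:ℝ) * Real.Gamma 2 = ((x ^ 2 + y ^ 2) ^ 2)⁻¹ := by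
      rw [Real.Gamma_two, mul_one, Real.rpow_two, one_div, inv_pow]
    rw [hv] at hI
    refine ⟨?_, ?_⟩
    · refine Integrable.const_mul ?_ _
      -- Integrability is read off from the value: a non-integrable function would have integral 0,
      -- whereas the formula gives a positive number.
      refine not_not.1 fun hn => ?_
      rw [integral_undef hn] at hI
      have : 0 < ((x ^ 2 + y ^ 2) ^ 2)⁻¹ := by positivity
      linarith
    · rw [integral_const_mul, hI]; rfl

end

lemma scaleCorr_nonneg (x y : ℝ) : 0 ≤ scaleCorr x y := by
  unfold scaleCorr; positivity

lemma scaleCorr_le_one (x y : ℝ) : scaleCorr x y ≤ 1 := by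
  refine div_le_one_of_le₀ ?_ (by positivity)
  nlinarith [sq_nonneg (x ^ 2 - y ^ 2)]

/-- `1 - ρ = (x - y)² (x + y)² / (x² + y²)²`, and `(x + y)² ≤ 2 (x² + y²)`. The factor `(y - x)²`
cancels the diagonal singularity of the Gram kernel. -/
lemma one_sub_scaleCorr_le {x : ℝ} (hx : x ≠ 0) (y : ℝ) :
    1 - scaleCorr x y ≤ (y - x) ^ 2 * (2 * (x ^ 2 + y ^ 2)⁻¹) := by
  have h : 0 < x ^ 2 + y ^ 2 := by positivity
  have e : (y - x) ^ 2 * (2 * (x ^ 2 + y ^ 2)⁻¹) - (1 - scaleCorr x y)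
      = (y - x) ^ 4 / (x ^ 2 + y ^ 2) ^ 2 := by
    rw [scaleCorr]; field_simp; ring
  have : 0 ≤ (y - x) ^ 4 / (x ^ 2 + y ^ 2) ^ 2 := by positivity
  linarith

/-- The integral is `∫ x² e^(-s x²) ds = 1` for `x ≠ 0`: the squared bumps form a partition of unity
over scales. -/
lemma lintegral_bumpScale_sq_le (x : ℝ) :
    ∫⁻ s in Ioi (0:ℝ), ENNReal.ofReal (bumpScale s x ^ 2) ≤ 1 := by
  rcases eq_or_ne x 0 with rfl | hx
  · simp [bumpScale]
  · have hr : 0 < x ^ 2 := by positivity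
    have e : ∀ s : ℝ, bumpScale s x ^ 2
        = x ^ 2 * (s ^ ((1:ℝ) - 1) * Real.exp (-(x ^ 2 * s))) := fun s => by
      rw [bumpScale_sq, sub_self, Real.rpow_zero, one_mul, mul_comm s]
    have hI := Real.integral_rpow_mul_exp_neg_mul_Ioi (a := 1) (by norm_num) hr
    rw [Real.rpow_one, Real.Gamma_one, mul_one] at hI
    have hi : IntegrableOn (fun s : ℝ => s ^ ((1:ℝ) - 1) * Real.exp (-(x ^ 2 * s))) (Ioi 0) := by
      refine not_not.1 fun hn => ?_
      rw [integral_undef hn] at hI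
      have : 0 < 1 / x ^ 2 := by positivity
      linarith
    simp_rw [e]
    rw [← ofReal_integral_eq_lintegral_ofReal (hi.const_mul _), integral_const_mul, hI]
    · rw [mul_one_div_cancel hr.ne']; simp
    · filter_upwards [ae_restrict_mem measurableSet_Ioi] with s hs
      rw [← e]; positivity

/-! ### The high part, and removal of the weight -/

section

variable {m : ℝ → ℝ → ℂ} {D : ℝ≥0} {f : ℝ → ℂ}

lemma integrable_form (hfm : Measurable f) (hf : Integrable f) {K : ℝ → ℝ → ℂ}
    (hK : Measurable (uncurry K)) {c : ℝ} (hc : ∀ x y, ‖K x y‖ ≤ c) :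
    Integrable (fun z : ℝ × ℝ => conj (f z.1) * f z.2 * K z.1 z.2) := by
  have hcf : Integrable (fun x => conj (f x)) := hf.norm.mono'
    (Complex.continuous_conj.measurable.comp hfm).aestronglyMeasurable
    (ae_of_all _ fun x => by simp)
  exact (hcf.mul_prod hf).mul_bdd (c := c) hK.aestronglyMeasurable
    (ae_of_all _ fun z => hc z.1 z.2)

/-- The form with kernel `K * scaleCorr` is a superposition of localised forms. -/
lemma integral_form_mul_scaleCorr {G : ℝ × ℝ → ℂ} (hG : Integrable G) :
    ∫ z, G z * (scaleCorr z.1 z.2 : ℂ)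
      = ∫ s in Ioi (0:ℝ), ∫ z : ℝ × ℝ,
        G z * ((4 * s * (bumpScale s z.1 ^ 2 * bumpScale s z.2 ^ 2) : ℝ) : ℂ) := by
  have e : ∀ z : ℝ × ℝ, G z * (scaleCorr z.1 z.2 : ℂ)
      = ∫ s in Ioi (0:ℝ), G z * ((4 * s * (bumpScale s z.1 ^ 2 * bumpScale s z.2 ^ 2) : ℝ) : ℂ) := by
    intro z
    rw [integral_const_mul, integral_complex_ofReal, (integral_scaleCorr z.1 z.2).2]
  simp_rw [e]
  refine integral_integral_swap ?_
  have hk : Measurable fun p : (ℝ × ℝ) × ℝ =>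
      ((4 * p.2 * (bumpScale p.2 p.1.1 ^ 2 * bumpScale p.2 p.1.2 ^ 2) : ℝ) : ℂ) := by
    unfold bumpScale; fun_prop
  have hm : AEStronglyMeasurable (uncurry fun (z : ℝ × ℝ) (s : ℝ) =>
      G z * ((4 * s * (bumpScale s z.1 ^ 2 * bumpScale s z.2 ^ 2) : ℝ) : ℂ))
      (volume.prod (volume.restrict (Ioi 0))) :=
    hG.aestronglyMeasurable.comp_fst.mul hk.aestronglyMeasurable
  rw [integrable_prod_iff hm]
  refine ⟨ae_of_all _ fun z => ?_, ?_⟩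
  · have h : Integrable (fun s : ℝ =>
        ((4 * s * (bumpScale s z.1 ^ 2 * bumpScale s z.2 ^ 2) : ℝ) : ℂ))
        (volume.restrict (Ioi 0)) := (integral_scaleCorr z.1 z.2).1.ofReal
    exact h.const_mul (G z)
  refine hG.norm.mono' hm.norm.integral_prod_right' (ae_of_all _ fun z => ?_)
  have : ∫ s in Ioi (0:ℝ),
      ‖G z * ((4 * s * (bumpScale s z.1 ^ 2 * bumpScale s z.2 ^ 2) : ℝ) : ℂ)‖
      = ‖G z‖ * scaleCorr z.1 z.2 := by
    rw [← (integral_scaleCorr z.1 z.2).2, ← integral_const_mul]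
    refine setIntegral_congr_fun measurableSet_Ioi fun s hs => ?_
    have hs : 0 < s := hs
    rw [norm_mul, Complex.norm_real, Real.norm_of_nonneg (by positivity)]
  simp only [uncurry]
  rw [this, Real.norm_of_nonneg (mul_nonneg (norm_nonneg _) (scaleCorr_nonneg _ _))]
  exact mul_le_of_le_one_right (norm_nonneg _) (scaleCorr_le_one _ _)

/-- At each scale the form is `4s` times a weighted norm of `S(a_s² f)`. The single-scale estimate
contributes `1/s`, cancelling `s`, and the partition of unity sums the scales. -/
lemma enorm_form_scaleCorr_le (hm : IsBiSymbol m D) (hD : 0 < D) (hfm : Measurable f)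
    (hf : Integrable f) {l : ℝ} (hl : 0 < l) :
    ‖∫ z : ℝ × ℝ, conj (f z.1) * f z.2 *
        gramKernel (oscKernel (highPart m)) (cauchyWeight l) z.1 z.2 * (scaleCorr z.1 z.2 : ℂ)‖ₑ
      ≤ ENNReal.ofReal (4 * bumpConst * D ^ 2) * ∫⁻ x, ‖f x‖ₑ ^ 2 := by
  have hkm := measurable_oscKernel (measurable_highPart hm.measurable)
  have hkc : ∀ x ξ, ‖oscKernel (highPart m) x ξ‖ ≤ D :=
    fun x ξ => (norm_oscKernel _ x ξ).trans_le (norm_highPart_le hm x ξ)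
  have hwi := (integrable_and_integral_cauchyWeight hl).1
  have hw0 : ∀ ξ, 0 ≤ cauchyWeight l ξ := fun ξ => (cauchyWeight_pos hl.le ξ).le
  have hKm := measurable_gramKernel hkm (measurable_cauchyWeight l)
  have hG := integrable_form hfm hf hKm (norm_gramKernel_le hkc hwi hw0)
  have hbm2 : Measurable fun p : ℝ × ℝ => ENNReal.ofReal (bumpScale p.1 p.2 ^ 2) := by
    unfold bumpScale; fun_prop
  rw [integral_form_mul_scaleCorr hG]
  refine (enorm_integral_le_lintegral_enorm _).trans ?_
  calc ∫⁻ s in Ioi (0:ℝ), ‖∫ z : ℝ × ℝ, conj (f z.1) * f z.2 *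
        gramKernel (oscKernel (highPart m)) (cauchyWeight l) z.1 z.2 *
          ((4 * s * (bumpScale s z.1 ^ 2 * bumpScale s z.2 ^ 2) : ℝ) : ℂ)‖ₑ
      ≤ ∫⁻ s in Ioi (0:ℝ), ENNReal.ofReal (4 * bumpConst * D ^ 2) *
          ∫⁻ x, ENNReal.ofReal (bumpScale s x ^ 2) * ‖f x‖ₑ ^ 2 := by
        refine setLIntegral_mono' measurableSet_Ioi fun s hs => ?_
        have hs : 0 < s := hs
        have hbm := measurable_bumpScale s
        have hgm : Measurable (fun x => (bumpScale s x : ℂ) * f x) := by fun_prop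
        have hbd : ∀ x, ‖(bumpScale s x : ℂ)‖ ≤ √s⁻¹ := fun x => by
          simpa using abs_bumpScale_le hs x
        have hg : Integrable (fun x => (bumpScale s x : ℂ) * f x) :=
          hf.bdd_mul (by fun_prop) (ae_of_all _ hbd)
        have hhm : Measurable (fun x => (bumpScale s x : ℂ) * ((bumpScale s x : ℂ) * f x)) := by
          fun_prop
        have hh : Integrable (fun x => (bumpScale s x : ℂ) * ((bumpScale s x : ℂ) * f x)) :=
          hg.bdd_mul (by fun_prop) (ae_of_all _ hbd)
        -- Of the two factors `a_s`, the outer one feeds the single-scale estimate and the inner one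
        -- stays with `f`, producing `∫ a_s² |f|²`.
        have e : ∀ z : ℝ × ℝ, conj (f z.1) * f z.2 *
            gramKernel (oscKernel (highPart m)) (cauchyWeight l) z.1 z.2 *
              ((4 * s * (bumpScale s z.1 ^ 2 * bumpScale s z.2 ^ 2) : ℝ) : ℂ)
            = ((4 * s : ℝ) : ℂ) * (conj ((bumpScale s z.1 : ℂ) * ((bumpScale s z.1 : ℂ) * f z.1)) *
              ((bumpScale s z.2 : ℂ) * ((bumpScale s z.2 : ℂ) * f z.2)) *
              gramKernel (oscKernel (highPart m)) (cauchyWeight l) z.1 z.2) := fun z => by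
          simp only [map_mul, Complex.conj_ofReal]
          push_cast
          ring
        simp_rw [e]
        rw [integral_const_mul, enorm_mul,
          ← lintegral_weight_kernelOp_sq hkm hkc hwi hw0 hhm hh,
          ← ofReal_norm, Complex.norm_real, Real.norm_of_nonneg (by positivity)]
        calc ENNReal.ofReal (4 * s) * ∫⁻ ξ, ENNReal.ofReal (cauchyWeight l ξ) *
              ‖kernelOp (oscKernel (highPart m))
                (fun x => (bumpScale s x : ℂ) * ((bumpScale s x : ℂ) * f x)) ξ‖ₑ ^ 2
            ≤ ENNReal.ofReal (4 * s) * (ENNReal.ofReal (bumpConst * D ^ 2 / s) *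
                ∫⁻ x, ‖(bumpScale s x : ℂ) * f x‖ₑ ^ 2) := by
              gcongr
              exact lintegral_weight_highPart_bumpScale_le hm hD hgm hg hl hs
          _ = _ := by
              rw [← mul_assoc, ← ENNReal.ofReal_mul (by positivity)]
              congr 1
              · congr 1; field_simp
              · refine lintegral_congr fun x => ?_
                rw [enorm_mul, mul_pow, ← ofReal_norm, Complex.norm_real,
                  ← ENNReal.ofReal_pow (norm_nonneg _), Real.norm_eq_abs, sq_abs]
    _ = ENNReal.ofReal (4 * bumpConst * D ^ 2) * ∫⁻ s in Ioi (0:ℝ),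
          ∫⁻ x, ENNReal.ofReal (bumpScale s x ^ 2) * ‖f x‖ₑ ^ 2 := by
        rw [lintegral_const_mul]
        exact (hbm2.mul (by fun_prop : Measurable fun p : ℝ × ℝ => ‖f p.2‖ₑ ^ 2)).lintegral_prod_right'
    _ ≤ _ := by
        refine mul_le_mul_right ?_ _
        rw [lintegral_lintegral_swap (hbm2.mul
          (by fun_prop : Measurable fun p : ℝ × ℝ => ‖f p.2‖ₑ ^ 2)).aemeasurable]
        refine lintegral_mono fun x => ?_
        rw [lintegral_mul_const _ (by unfold bumpScale; fun_prop)]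
        exact mul_le_of_le_one_left zero_le (lintegral_bumpScale_sq_le x)

/-- The weight `|y|^(-1/2)` cancels `√|y|`, leaving a Cauchy integral of mass `π / |x|`. -/
lemma lintegral_sqrt_kernel_le {A : ℝ} (hA : 0 ≤ A) {x : ℝ} (hx : x ≠ 0) :
    ∫⁻ y, ENNReal.ofReal (A * √(|x| * |y|) * (x ^ 2 + y ^ 2)⁻¹) * invSqrtWeight y
      ≤ ENNReal.ofReal (A * Real.pi) * invSqrtWeight x := by
  have hx' : 0 < |x| := abs_pos.2 hx
  have hsx : 0 < √|x| := Real.sqrt_pos.2 hx'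
  calc ∫⁻ y, ENNReal.ofReal (A * √(|x| * |y|) * (x ^ 2 + y ^ 2)⁻¹) * invSqrtWeight y
      ≤ ∫⁻ y, ENNReal.ofReal (A * √|x|) * ENNReal.ofReal (|x| ^ 2 + y ^ 2)⁻¹ := by
        refine lintegral_mono fun y => ?_
        rw [← ENNReal.ofReal_coe_nnreal, coe_invSqrtWeight, ← ENNReal.ofReal_mul (by positivity),
          ← ENNReal.ofReal_mul (by positivity)]
        refine ENNReal.ofReal_le_ofReal ?_
        rw [Real.sqrt_mul (abs_nonneg x), sq_abs]
        calc A * (√|x| * √|y|) * (x ^ 2 + y ^ 2)⁻¹ * (√|y|)⁻¹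
            = A * √|x| * (x ^ 2 + y ^ 2)⁻¹ * (√|y| * (√|y|)⁻¹) := by ring
          _ ≤ _ := mul_le_of_le_one_right (by positivity) mul_inv_le_one
    _ = ENNReal.ofReal (A * √|x|) * ENNReal.ofReal (Real.pi / |x|) := by
        rw [lintegral_const_mul _ (by fun_prop), lintegral_inv_sq_add_sq hx']
    _ = _ := by
        rw [← ENNReal.ofReal_coe_nnreal, coe_invSqrtWeight, ← ENNReal.ofReal_mul (by positivity),
          ← ENNReal.ofReal_mul (by positivity)]
        congr 1
        field_simp
        rw [Real.sq_sqrt hx'.le]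

lemma enorm_form_one_sub_scaleCorr_le (hm : IsBiSymbol m D) (hfm : Measurable f)
    {l : ℝ} (hl : 0 < l) :
    ‖∫ z : ℝ × ℝ, conj (f z.1) * f z.2 *
        (gramKernel (oscKernel (highPart m)) (cauchyWeight l) z.1 z.2 *
          ((1 - scaleCorr z.1 z.2 : ℝ) : ℂ))‖ₑ
      ≤ ENNReal.ofReal (1024000 * Real.pi ^ 2 * D ^ 2) * ∫⁻ x, ‖f x‖ₑ ^ 2 := by
  have hkm := measurable_oscKernel (measurable_highPart hm.measurable)
  have hKm := measurable_gramKernel hkm (measurable_cauchyWeight l)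
  have hscm : Measurable fun z : ℝ × ℝ => ((1 - scaleCorr z.1 z.2 : ℝ) : ℂ) := by
    unfold scaleCorr; fun_prop
  set A : ℝ := 512000 * D ^ 2 * Real.pi with hA
  have hA0 : 0 ≤ A := by positivity
  refine (enorm_integral_form_le (G := fun x y =>
    gramKernel (oscKernel (highPart m)) (cauchyWeight l) x y *
      ((1 - scaleCorr x y : ℝ) : ℂ)) (hKm.mul hscm) hfm).trans ?_
  calc _ ≤ ∫⁻ x, ∫⁻ y, (‖f x‖₊ : ℝ≥0∞) * ‖f y‖₊ *
          ENNReal.ofReal (A * √(|x| * |y|) * (x ^ 2 + y ^ 2)⁻¹) := by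
        refine lintegral_mono_ae ?_
        filter_upwards [ae_ne_zero_real] with x hx
        refine lintegral_mono fun y => ?_
        gcongr
        rw [← ofReal_norm]
        refine ENNReal.ofReal_le_ofReal ?_
        rw [norm_mul, Complex.norm_real,
          Real.norm_of_nonneg (sub_nonneg.2 (scaleCorr_le_one x y))]
        calc _ ≤ ‖gramKernel (oscKernel (highPart m)) (cauchyWeight l) x y‖ *
              ((y - x) ^ 2 * (2 * (x ^ 2 + y ^ 2)⁻¹)) := by
              gcongr; exact one_sub_scaleCorr_le hx y
          _ = ((y - x) ^ 2 * ‖gramKernel (oscKernel (highPart m)) (cauchyWeight l) x y‖) *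
              (2 * (x ^ 2 + y ^ 2)⁻¹) := by ring
          _ ≤ (256000 * D ^ 2 * Real.pi * √(|x| * |y|)) * (2 * (x ^ 2 + y ^ 2)⁻¹) := by
              exact mul_le_mul_of_nonneg_right (sq_mul_norm_gramKernel_highPart_le hm hl x y)
                (by positivity)
          _ = _ := by rw [hA]; ring
    _ ≤ 2 * ENNReal.ofReal (A * Real.pi) * ∫⁻ x, (‖f x‖₊ : ℝ≥0∞) ^ 2 :=
        lintegral_schur (by simp only [uncurry_def]; fun_prop)
          (fun x y => by rw [mul_comm |x|, add_comm (x ^ 2)]) measurable_invSqrtWeight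
          (fun x hx => invSqrtWeight_ne_zero hx) (fun x hx => lintegral_sqrt_kernel_le hA0 hx)
          (by fun_prop)
    _ = _ := by
        have e : 1024000 * Real.pi ^ 2 * (D:ℝ) ^ 2 = 2 * (A * Real.pi) := by rw [hA]; ring
        rw [e, ENNReal.ofReal_mul (p := 2) (by norm_num), ENNReal.ofReal_ofNat]
        rfl

noncomputable def highConst : ℝ := 4 * bumpConst + 1024000 * Real.pi ^ 2

/-- Adds the near-diagonal superposition of scales and the off-diagonal Schur piece, `1 = ρ + (1 -
ρ)`. -/
lemma lintegral_weight_highPart_le (hm : IsBiSymbol m D) (hD : 0 < D) (hfm : Measurable f)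
    (hf : Integrable f) {l : ℝ} (hl : 0 < l) :
    ∫⁻ ξ, ENNReal.ofReal (cauchyWeight l ξ) * ‖kernelOp (oscKernel (highPart m)) f ξ‖ₑ ^ 2
      ≤ ENNReal.ofReal (highConst * D ^ 2) * ∫⁻ x, ‖f x‖ₑ ^ 2 := by
  have hkm := measurable_oscKernel (measurable_highPart hm.measurable)
  have hkc : ∀ x ξ, ‖oscKernel (highPart m) x ξ‖ ≤ D :=
    fun x ξ => (norm_oscKernel _ x ξ).trans_le (norm_highPart_le hm x ξ)
  have hwi := (integrable_and_integral_cauchyWeight hl).1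
  have hw0 : ∀ ξ, 0 ≤ cauchyWeight l ξ := fun ξ => (cauchyWeight_pos hl.le ξ).le
  have hKm := measurable_gramKernel hkm (measurable_cauchyWeight l)
  have hG := integrable_form hfm hf hKm (norm_gramKernel_le hkc hwi hw0)
  have hscm : Measurable fun z : ℝ × ℝ => (scaleCorr z.1 z.2 : ℂ) := by
    unfold scaleCorr; fun_prop
  rw [lintegral_weight_kernelOp_sq hkm hkc hwi hw0 hfm hf]
  have e : ∀ z : ℝ × ℝ, conj (f z.1) * f z.2 *
        gramKernel (oscKernel (highPart m)) (cauchyWeight l) z.1 z.2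
      = conj (f z.1) * f z.2 * gramKernel (oscKernel (highPart m)) (cauchyWeight l) z.1 z.2 *
          (scaleCorr z.1 z.2 : ℂ)
        + conj (f z.1) * f z.2 *
        (gramKernel (oscKernel (highPart m)) (cauchyWeight l) z.1 z.2 *
          ((1 - scaleCorr z.1 z.2 : ℝ) : ℂ)) := fun z => by push_cast; ring
  have i1 : Integrable fun z : ℝ × ℝ => conj (f z.1) * f z.2 *
      gramKernel (oscKernel (highPart m)) (cauchyWeight l) z.1 z.2 * (scaleCorr z.1 z.2 : ℂ) :=
    hG.mul_bdd (c := 1) hscm.aestronglyMeasurable (ae_of_all _ fun z => by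
      rw [Complex.norm_real, Real.norm_of_nonneg (scaleCorr_nonneg _ _)]
      exact scaleCorr_le_one _ _)
  have i2 : Integrable fun z : ℝ × ℝ => conj (f z.1) * f z.2 *
      (gramKernel (oscKernel (highPart m)) (cauchyWeight l) z.1 z.2 *
        ((1 - scaleCorr z.1 z.2 : ℝ) : ℂ)) :=
    (hG.sub i1).congr (ae_of_all _ fun z => by
      simp only [Pi.sub_apply]; push_cast; ring)
  rw [integral_congr_ae (ae_of_all _ e), integral_add i1 i2]
  refine (enorm_add_le _ _).trans ((add_le_add (enorm_form_scaleCorr_le hm hD hfm hf hl)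
    (enorm_form_one_sub_scaleCorr_le hm hfm hl)).trans (le_of_eq ?_))
  have := bumpConst_pos
  rw [← add_mul, ← ENNReal.ofReal_add (by positivity) (by positivity), highConst]
  congr 2
  ring

noncomputable def totalConst : ℝ := 2 * highConst + 4 * hardyConst.toReal ^ 2

lemma totalConst_pos : 0 < totalConst := by
  have := bumpConst_pos
  unfold totalConst highConst; positivity

lemma lintegral_weight_oscKernel_le (hm : IsBiSymbol m D) (hD : 0 < D) (hfm : Measurable f)
    (hf : Integrable f) {l : ℝ} (hl : 0 < l) :
    ∫⁻ ξ, ENNReal.ofReal (cauchyWeight l ξ) * ‖kernelOp (oscKernel m) f ξ‖ₑ ^ 2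
      ≤ ENNReal.ofReal (totalConst * D ^ 2) * ∫⁻ x, ‖f x‖ₑ ^ 2 := by
  have hTm : Measurable (kernelOp (oscKernel m) f) :=
    measurable_kernelOp (measurable_oscKernel hm.measurable) hfm
  have hSm : Measurable (kernelOp (oscKernel (highPart m)) f) :=
    measurable_kernelOp (measurable_oscKernel (measurable_highPart hm.measurable)) hfm
  have hwm := measurable_cauchyWeight l
  have hH : hardyConst = ENNReal.ofReal hardyConst.toReal :=
    (ENNReal.ofReal_toReal hardyConst_lt_top.ne).symm
  have hh : 0 ≤ highConst := by
    have := bumpConst_pos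
    unfold highConst; positivity
  calc ∫⁻ ξ, ENNReal.ofReal (cauchyWeight l ξ) * ‖kernelOp (oscKernel m) f ξ‖ₑ ^ 2
      ≤ ∫⁻ ξ, (2 * (ENNReal.ofReal (cauchyWeight l ξ) *
            ‖kernelOp (oscKernel (highPart m)) f ξ‖ₑ ^ 2)
          + 2 * ‖kernelOp (oscKernel m) f ξ - kernelOp (oscKernel (highPart m)) f ξ‖ₑ ^ 2) := by
        refine lintegral_mono fun ξ => ?_
        have h1 : ENNReal.ofReal (cauchyWeight l ξ) ≤ 1 :=
          ENNReal.ofReal_le_one.2 (cauchyWeight_le_one hl.le ξ)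
        have h2 := enorm_sq_le_two_mul (kernelOp (oscKernel m) f ξ)
          (kernelOp (oscKernel (highPart m)) f ξ)
        refine (mul_le_mul_right h2 _).trans ?_
        rw [mul_add, mul_left_comm]
        exact add_le_add le_rfl (mul_le_of_le_one_left zero_le h1)
    _ = 2 * (∫⁻ ξ, ENNReal.ofReal (cauchyWeight l ξ) *
            ‖kernelOp (oscKernel (highPart m)) f ξ‖ₑ ^ 2)
          + 2 * ∫⁻ ξ, ‖kernelOp (oscKernel m) f ξ
            - kernelOp (oscKernel (highPart m)) f ξ‖ₑ ^ 2 := by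
        rw [lintegral_add_left (by fun_prop), lintegral_const_mul _ (by fun_prop),
          lintegral_const_mul _ (by fun_prop)]
    _ ≤ 2 * (ENNReal.ofReal (highConst * D ^ 2) * ∫⁻ x, ‖f x‖ₑ ^ 2)
          + 2 * (2 * hardyConst ^ 2 * D ^ 2 * ∫⁻ x, ‖f x‖ₑ ^ 2) := by
        gcongr
        · exact lintegral_weight_highPart_le hm hD hfm hf hl
        · exact lintegral_lowPart_sq_le hm hfm hf
    _ = _ := by
        have e : totalConst * (D:ℝ) ^ 2 = 2 * (highConst * D ^ 2)
            + 2 * (2 * hardyConst.toReal ^ 2 * D ^ 2) := by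
          rw [totalConst]; ring
        rw [e, ENNReal.ofReal_add (by positivity) (by positivity), add_mul]
        congr 1
        · rw [ENNReal.ofReal_mul (p := 2) (by norm_num), ENNReal.ofReal_ofNat]; ring
        · rw [ENNReal.ofReal_mul (p := 2) (by norm_num), ENNReal.ofReal_mul (by positivity),
            ENNReal.ofReal_mul (p := 2) (by norm_num),
            ENNReal.ofReal_pow (by positivity), ← hH, ENNReal.ofReal_pow (by positivity),
            ENNReal.ofReal_coe_nnreal, ENNReal.ofReal_ofNat]
          ring

/-- The `L²` bound for integrable functions. -/
lemma lintegral_oscKernel_le (hm : IsBiSymbol m D) (hD : 0 < D) (hfm : Measurable f)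
    (hf : Integrable f) :
    ∫⁻ ξ, ‖kernelOp (oscKernel m) f ξ‖ₑ ^ 2
      ≤ ENNReal.ofReal (totalConst * D ^ 2) * ∫⁻ x, ‖f x‖ₑ ^ 2 := by
  have hTm : Measurable (kernelOp (oscKernel m) f) :=
    measurable_kernelOp (measurable_oscKernel hm.measurable) hfm
  have hlim : ∀ ξ, Tendsto (fun n : ℕ => ENNReal.ofReal (cauchyWeight (1 / ((n:ℝ) + 1)) ξ) *
      ‖kernelOp (oscKernel m) f ξ‖ₑ ^ 2) atTop (𝓝 (‖kernelOp (oscKernel m) f ξ‖ₑ ^ 2)) := by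
    intro ξ
    have h1 : Tendsto (fun n : ℕ => cauchyWeight (1 / ((n:ℝ) + 1)) ξ) atTop (𝓝 1) := by
      have : Tendsto (fun n : ℕ => (1 + (1 / ((n:ℝ) + 1)) * ξ ^ 2)⁻¹) atTop
          (𝓝 ((1 + 0 * ξ ^ 2)⁻¹)) :=
        ((tendsto_one_div_add_atTop_nhds_zero_nat.mul_const _).const_add 1).inv₀ (by simp)
      simpa [cauchyWeight] using this
    have h2 := ENNReal.Tendsto.mul_const (b := ‖kernelOp (oscKernel m) f ξ‖ₑ ^ 2)
      (ENNReal.tendsto_ofReal h1) (Or.inl (by simp))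
    simpa using h2
  -- Fatou's lemma along `l = 1 / (n + 1)`, the weighted bounds being uniform in `l`.
  calc ∫⁻ ξ, ‖kernelOp (oscKernel m) f ξ‖ₑ ^ 2
      = ∫⁻ ξ, liminf (fun n : ℕ => ENNReal.ofReal (cauchyWeight (1 / ((n:ℝ) + 1)) ξ) *
          ‖kernelOp (oscKernel m) f ξ‖ₑ ^ 2) atTop :=
        lintegral_congr fun ξ => ((hlim ξ).liminf_eq).symm
    _ ≤ liminf (fun n : ℕ => ∫⁻ ξ, ENNReal.ofReal (cauchyWeight (1 / ((n:ℝ) + 1)) ξ) *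
          ‖kernelOp (oscKernel m) f ξ‖ₑ ^ 2) atTop :=
        lintegral_liminf_le fun n => by
          have := measurable_cauchyWeight (1 / ((n:ℝ) + 1)); fun_prop
    _ ≤ _ := by
        refine liminf_le_of_le (by isBoundedDefault) fun b hb => ?_
        obtain ⟨n, hn⟩ := hb.exists
        exact hn.trans (lintegral_weight_oscKernel_le hm hD hfm hf (by positivity))

end

/-! ### From the hypotheses on `m` to symbol bounds -/

lemma hasDerivAt_deriv_deriv_of_contDiffOn {f : ℝ → ℂ} {s : Set ℝ} (hs : IsOpen s)
    (hf : ContDiffOn ℝ ∞ f s) {t : ℝ} (ht : t ∈ s) :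
    HasDerivAt f (deriv f t) t ∧ HasDerivAt (deriv f) (deriv (deriv f) t) t := by
  have h2 : ContDiffOn ℝ ∞ (deriv f) s := hf.deriv_of_isOpen hs (by simp)
  exact ⟨((hf.differentiableOn (by simp)).differentiableAt (hs.mem_nhds ht)).hasDerivAt,
    ((h2.differentiableOn (by simp)).differentiableAt (hs.mem_nhds ht)).hasDerivAt⟩

lemma japBracket_pos (x : ℝ) : 0 < japBracket x := Real.sqrt_pos.2 (by positivity)

lemma abs_le_japBracket (x : ℝ) : |x| ≤ japBracket x :=
  Real.abs_le_sqrt (by linarith)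

lemma hasDerivAt_japBracket (x : ℝ) : HasDerivAt japBracket (x / japBracket x) x := by
  have h : HasDerivAt (fun x : ℝ => 1 + x ^ 2) (2 * x) x := by
    refine ((hasDerivAt_pow 2 x).const_add 1).congr_deriv (by simp)
  refine (h.sqrt (by positivity)).congr_deriv ?_
  rw [japBracket]; field_simp

/-- `t² g'' = (t∂)² g - t∂g`, with `g₁` playing the role of `g'`. -/
lemma norm_sq_mul_deriv_deriv_le_of_euler {g₁ : ℝ → ℂ} {b : ℝ} {t : ℝ} {g₂ : ℂ}
    (h1 : ‖(t : ℂ) * g₁ t‖ ≤ b) (h2 : HasDerivAt g₁ g₂ t)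
    (h : ‖(t : ℂ) * deriv (fun η : ℝ => (η : ℂ) * g₁ η) t‖ ≤ b) :
    t ^ 2 * ‖g₂‖ ≤ 2 * b := by
  have d : HasDerivAt (fun η : ℝ => (η : ℂ) * g₁ η) (1 * g₁ t + t * g₂) t :=
    (Complex.ofRealCLM.hasDerivAt (x := t)).mul h2
  rw [d.deriv] at h
  have e : ((t ^ 2 : ℝ) : ℂ) * g₂ = (t : ℂ) * (1 * g₁ t + t * g₂) - t * g₁ t := by
    push_cast; ring
  calc t ^ 2 * ‖g₂‖ = ‖((t ^ 2 : ℝ) : ℂ) * g₂‖ := by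
        rw [norm_mul, Complex.norm_real, Real.norm_of_nonneg (sq_nonneg t)]
    _ ≤ b + b := by rw [e]; exact (norm_sub_le _ _).trans (add_le_add h h1)
    _ = _ := by ring

/-- `⟨x⟩² g'' = (⟨x⟩∂)² g - (x/⟨x⟩) ⟨x⟩∂g`, since `⟨x⟩' = x/⟨x⟩` has modulus at most 1. -/
lemma norm_sq_mul_deriv_deriv_le_of_bracket {g₁ : ℝ → ℂ} {b : ℝ} {x : ℝ} {g₂ : ℂ}
    (h1 : ‖(japBracket x : ℂ) * g₁ x‖ ≤ b) (h2 : HasDerivAt g₁ g₂ x)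
    (h : ‖(japBracket x : ℂ) * deriv (fun y : ℝ => (japBracket y : ℂ) * g₁ y) x‖ ≤ b) :
    x ^ 2 * ‖g₂‖ ≤ 2 * b := by
  have hj := japBracket_pos x
  have hxj := abs_le_japBracket x
  have d : HasDerivAt (fun y : ℝ => (japBracket y : ℂ) * g₁ y)
      (((x / japBracket x : ℝ) : ℂ) * g₁ x + japBracket x * g₂) x :=
    (hasDerivAt_japBracket x).ofReal_comp.mul h2
  rw [d.deriv] at h
  have e : ((japBracket x ^ 2 : ℝ) : ℂ) * g₂
      = (japBracket x : ℂ) * (((x / japBracket x : ℝ) : ℂ) * g₁ x + japBracket x * g₂)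
        - ((x / japBracket x : ℝ) : ℂ) * (japBracket x * g₁ x) := by
    push_cast; ring
  have hq : ‖((x / japBracket x : ℝ) : ℂ)‖ ≤ 1 := by
    rw [Complex.norm_real, Real.norm_eq_abs, abs_div, abs_of_pos hj]
    exact div_le_one_of_le₀ hxj hj.le
  calc x ^ 2 * ‖g₂‖ ≤ japBracket x ^ 2 * ‖g₂‖ := by
        rw [← sq_abs]; gcongr
    _ = ‖((japBracket x ^ 2 : ℝ) : ℂ) * g₂‖ := by
        rw [norm_mul, Complex.norm_real, Real.norm_of_nonneg (sq_nonneg _)]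
    _ ≤ b + b := by
        rw [e]
        refine (norm_sub_le _ _).trans (add_le_add h ?_)
        rw [norm_mul]
        exact (mul_le_of_le_one_left (norm_nonneg _) hq).trans h1
    _ = _ := by ring

/-- The symbol with its values at `ξ = 0` replaced by zero. -/
noncomputable def cutZero (m : ℝ → ℝ → ℂ) (x ξ : ℝ) : ℂ :=
  {p : ℝ × ℝ | p.2 ≠ 0}.indicator (fun p => m p.1 p.2) (x, ξ)

lemma cutZero_of_ne {m : ℝ → ℝ → ℂ} {x ξ : ℝ} (h : ξ ≠ 0) : cutZero m x ξ = m x ξ :=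
  indicator_of_mem (s := {p : ℝ × ℝ | p.2 ≠ 0}) (a := (x, ξ)) h _

lemma cutZero_zero (m : ℝ → ℝ → ℂ) (x : ℝ) : cutZero m x 0 = 0 :=
  indicator_of_notMem (s := {p : ℝ × ℝ | p.2 ≠ 0}) (a := (x, 0)) (by simp) _

/-- The factor 2 is the cost of replacing iterated first-order operators by pure second derivatives.
In `x`, only the weaker homogeneous bounds obtained from `|x| ≤ ⟨x⟩` are kept. -/
lemma isBiSymbol_cutZero {m : ℝ → ℝ → ℂ} {B : ℝ}
    (hm : ContDiffOn ℝ ∞ (fun p : ℝ × ℝ => m p.1 p.2) {p : ℝ × ℝ | p.2 ≠ 0})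
    (hB : ∀ k ≤ 2, ∀ l ≤ 2, ∀ x ξ : ℝ, ξ ≠ 0 →
          ‖(bracketDx^[k] m) x ξ‖ + ‖(eulerDxi^[l] m) x ξ‖ ≤ B) :
    IsBiSymbol (cutZero m) (2 * B) := by
  have hopen : IsOpen {p : ℝ × ℝ | p.2 ≠ 0} := isOpen_ne.preimage continuous_snd
  have hk : ∀ k ≤ 2, ∀ x ξ : ℝ, ξ ≠ 0 → ‖(bracketDx^[k] m) x ξ‖ ≤ B := fun k hk x ξ hξ =>
    (le_add_of_nonneg_right (norm_nonneg _)).trans (hB k hk 0 (by norm_num) x ξ hξ)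
  have hl : ∀ l ≤ 2, ∀ x ξ : ℝ, ξ ≠ 0 → ‖(eulerDxi^[l] m) x ξ‖ ≤ B := fun l hl x ξ hξ =>
    (le_add_of_nonneg_left (norm_nonneg _)).trans (hB 0 (by norm_num) l hl x ξ hξ)
  have hB0 : 0 ≤ B := (norm_nonneg _).trans (hk 0 (by norm_num) 0 1 one_ne_zero)
  refine ⟨?_, ?_, ?_, ?_⟩
  · classical
    have := ContinuousOn.measurable_piecewise (g := (0 : ℝ × ℝ → ℂ)) hm.continuousOn
      continuousOn_const hopen.measurableSet
    rw [piecewise_eq_indicator] at this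
    exact this
  · intro x ξ
    rcases eq_or_ne ξ 0 with rfl | h
    · rw [cutZero_zero, norm_zero]; positivity
    · rw [cutZero_of_ne h]
      exact (hk 0 (by norm_num) x ξ h).trans (by linarith)
  · intro ξ
    rcases eq_or_ne ξ 0 with rfl | h
    · refine ⟨fun _ => 0, fun _ => 0, fun t _ => ?_⟩
      simp only [cutZero_zero, norm_zero, mul_zero]
      exact ⟨hasDerivAt_const _ _, hasDerivAt_const _ _, by positivity, by positivity,
        by positivity⟩
    · have hs : ContDiffOn ℝ ∞ (fun x => m x ξ) univ :=
        hm.comp (contDiff_id.prodMk contDiff_const).contDiffOn fun x _ => h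
      simp only [cutZero_of_ne h]
      refine ⟨deriv fun x => m x ξ, deriv (deriv fun x => m x ξ), fun t _ => ?_⟩
      obtain ⟨d1, d2⟩ := hasDerivAt_deriv_deriv_of_contDiffOn isOpen_univ hs (mem_univ t)
      have b1 : ‖(japBracket t : ℂ) * deriv (fun x => m x ξ) t‖ ≤ B :=
        hk 1 (by norm_num) t ξ h
      refine ⟨d1, d2, (hk 0 (by norm_num) t ξ h).trans (by linarith), ?_,
        norm_sq_mul_deriv_deriv_le_of_bracket b1 d2 (hk 2 le_rfl t ξ h)⟩
      rw [norm_mul, Complex.norm_real, Real.norm_of_nonneg (japBracket_pos t).le] at b1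
      calc _ ≤ japBracket t * ‖deriv (fun x => m x ξ) t‖ := by
            gcongr; exact abs_le_japBracket t
        _ ≤ _ := by linarith
  · intro x
    have hs : ContDiffOn ℝ ∞ (fun η => m x η) {0}ᶜ :=
      hm.comp (contDiff_const.prodMk contDiff_id).contDiffOn fun η hη => hη
    refine ⟨deriv fun η => m x η, deriv (deriv fun η => m x η), fun t ht => ?_⟩
    obtain ⟨d1, d2⟩ := hasDerivAt_deriv_deriv_of_contDiffOn isOpen_compl_singleton hs ht
    have b1 : ‖(t : ℂ) * deriv (fun η => m x η) t‖ ≤ B := hl 1 (by norm_num) x t ht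
    refine ⟨d1.congr_of_eventuallyEq ?_, d2, ?_, ?_,
      norm_sq_mul_deriv_deriv_le_of_euler b1 d2 (hl 2 le_rfl x t ht)⟩
    · filter_upwards [isOpen_ne.mem_nhds ht] with η hη using cutZero_of_ne hη
    · simp only [cutZero_of_ne ht]
      exact (hk 0 (by norm_num) x t ht).trans (by linarith)
    · rw [norm_mul, Complex.norm_real, Real.norm_eq_abs] at b1
      linarith

lemma symbolIntegral_eq_kernelOp (m : ℝ → ℝ → ℂ) (f : ℝ → ℂ) {ξ : ℝ} (h : ξ ≠ 0) :
    symbolIntegral m f ξ = kernelOp (oscKernel (cutZero m)) f ξ := by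
  simp only [symbolIntegral, kernelOp, oscKernel, cutZero_of_ne h]

lemma lintegral_kernelOp_oscKernel_le {m : ℝ → ℝ → ℂ} {D : ℝ≥0} {f : ℝ → ℂ}
    (hm : IsBiSymbol m D) (hfm : Measurable f) (hf : Integrable f) :
    ∫⁻ ξ, ‖kernelOp (oscKernel m) f ξ‖ₑ ^ 2
      ≤ ENNReal.ofReal (totalConst * D ^ 2) * ∫⁻ x, ‖f x‖ₑ ^ 2 := by
  rcases eq_or_ne D 0 with rfl | hD
  · have : ∀ x ξ, m x ξ = 0 := fun x ξ => by simpa using hm.norm_le x ξ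
    simp [kernelOp, oscKernel, this]
  · exact lintegral_oscKernel_le hm (pos_iff_ne_zero.2 hD) hfm hf

/-! ### Extension to `L²` -/

lemma eLpNorm_two_le_of_lintegral {g f : ℝ → ℂ} {c : ℝ} (hc : 0 ≤ c)
    (h : ∫⁻ ξ, ‖g ξ‖ₑ ^ 2 ≤ ENNReal.ofReal (c ^ 2) * ∫⁻ x, ‖f x‖ₑ ^ 2) :
    eLpNorm g 2 volume ≤ ENNReal.ofReal c * eLpNorm f 2 volume := by
  have e : ∀ u : ℝ → ℂ, eLpNorm u 2 volume ^ 2 = ∫⁻ x, ‖u x‖ₑ ^ 2 := fun u => by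
    have := eLpNorm_nnreal_pow_eq_lintegral (f := u) (μ := volume) (p := 2) (by norm_num)
    simpa using this
  rw [← e, ← e, ENNReal.ofReal_pow hc, ← mul_pow] at h
  exact (ENNReal.pow_le_pow_left_iff two_ne_zero).1 h

/-- The square integrable functions which are also integrable. -/
def integrableLp : Submodule ℂ (Lp ℂ 2 (volume : Measure ℝ)) where
  carrier := {f | Integrable f volume}
  add_mem' {f g} hf hg := (Integrable.add hf hg).congr (Lp.coeFn_add f g).symm
  zero_mem' := (integrable_zero ℝ ℂ volume).congr (Lp.coeFn_zero ℂ 2 volume).symm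
  smul_mem' c f hf := (Integrable.smul c hf).congr (Lp.coeFn_smul c f).symm

/-- Simple functions in `L²` are integrable and already dense. -/
lemma denseRange_integrableLp : DenseRange integrableLp.subtype := by
  have h := Lp.simpleFunc.denseRange (E := ℂ) (μ := (volume : Measure ℝ)) (p := 2) (by simp)
  refine h.mono ?_
  rintro _ ⟨f, rfl⟩
  refine ⟨⟨(f : Lp ℂ 2 volume), ?_⟩, rfl⟩
  have h1 : Integrable (Lp.simpleFunc.toSimpleFunc f) volume :=
    (SimpleFunc.memLp_iff_integrable (by simp) (by simp)).1 (Lp.simpleFunc.memLp f)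
  exact h1.congr (Lp.simpleFunc.toSimpleFunc_eq_toFun f)

theorem mainTheorem5 :
    ∃ C : ℝ, 0 < C ∧
      ∀ (m : ℝ → ℝ → ℂ) (B : ℝ),
        ContDiffOn ℝ ∞ (fun p : ℝ × ℝ => m p.1 p.2) {p : ℝ × ℝ | p.2 ≠ 0} →
        (∀ k ≤ 2, ∀ l ≤ 2, ∀ x ξ : ℝ, ξ ≠ 0 →
          ‖(bracketDx^[k] m) x ξ‖ + ‖(eulerDxi^[l] m) x ξ‖ ≤ B) →
        ∃ T : Lp ℂ 2 (volume : Measure ℝ) →L[ℂ] Lp ℂ 2 (volume : Measure ℝ),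
          (∀ f : Lp ℂ 2 (volume : Measure ℝ), Integrable (f : ℝ → ℂ) volume →
            (T f : ℝ → ℂ) =ᵐ[volume] symbolIntegral m f) ∧
          ‖T‖ ≤ C * B := by
  have hC := totalConst_pos
  -- The square root of `totalConst * D ^ 2` with `D = 2B`.
  refine ⟨2 * √totalConst, by positivity, fun m B hm hB => ?_⟩
  have hB0 : 0 ≤ B := (add_nonneg (norm_nonneg _) (norm_nonneg _)).trans
    (hB 0 (by norm_num) 0 (by norm_num) 0 1 one_ne_zero)
  set D : ℝ≥0 := ⟨2 * B, by positivity⟩ with hD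
  have hs : IsBiSymbol (cutZero m) D := isBiSymbol_cutZero hm hB
  set k := oscKernel (cutZero m) with hk
  have hkm : Measurable (uncurry k) := measurable_oscKernel hs.measurable
  have hkc : ∀ x ξ, ‖k x ξ‖ ≤ D := fun x ξ => (norm_oscKernel _ x ξ).trans_le (hs.norm_le x ξ)
  have hae : ∀ f, symbolIntegral m f =ᵐ[volume] kernelOp k f := fun f => by
    filter_upwards [ae_ne_zero_real] with ξ hξ using symbolIntegral_eq_kernelOp m f hξ
  have hbound : ∀ f : integrableLp, eLpNorm (kernelOp k f) 2 volume
      ≤ ENNReal.ofReal (2 * √totalConst * B) * eLpNorm (f : Lp ℂ 2 (volume : Measure ℝ)) 2 volume :=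
    fun f => by
      refine eLpNorm_two_le_of_lintegral (by positivity) ?_
      have e : (2 * √totalConst * B) ^ 2 = totalConst * (D : ℝ) ^ 2 := by
        have : (D : ℝ) = 2 * B := rfl
        rw [this, mul_pow, mul_pow, Real.sq_sqrt hC.le]; ring
      rw [e]
      exact lintegral_kernelOp_oscKernel_le hs (Lp.stronglyMeasurable _).measurable f.2
  have hmem : ∀ f : integrableLp, MemLp (kernelOp k f) 2 volume := fun f =>
    ⟨(measurable_kernelOp hkm (Lp.stronglyMeasurable _).measurable).aestronglyMeasurable,
      (hbound f).trans_lt (ENNReal.mul_lt_top ENNReal.ofReal_lt_top (Lp.eLpNorm_lt_top _))⟩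
  let L : integrableLp →ₗ[ℂ] Lp ℂ 2 (volume : Measure ℝ) :=
    { toFun := fun f => (hmem f).toLp _
      map_add' := fun f g => by
        rw [← MemLp.toLp_add]
        refine MemLp.toLp_congr _ _ (ae_of_all _ fun ξ => ?_)
        simp only [Pi.add_apply, kernelOp]
        rw [← integral_add (integrable_kernel_mul hkm hkc f.2 ξ)
          (integrable_kernel_mul hkm hkc g.2 ξ)]
        refine integral_congr_ae ?_
        filter_upwards [Lp.coeFn_add (f : Lp ℂ 2 (volume : Measure ℝ)) g] with x hx
        rw [Submodule.coe_add, hx, Pi.add_apply, mul_add]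
      map_smul' := fun c f => by
        rw [RingHom.id_apply, ← MemLp.toLp_const_smul]
        refine MemLp.toLp_congr _ _ (ae_of_all _ fun ξ => ?_)
        simp only [Pi.smul_apply, kernelOp, smul_eq_mul]
        rw [← integral_const_mul]
        refine integral_congr_ae ?_
        filter_upwards [Lp.coeFn_smul c (f : Lp ℂ 2 (volume : Measure ℝ))] with x hx
        rw [Submodule.coe_smul, hx, Pi.smul_apply, smul_eq_mul, mul_left_comm] }
  have hL : ∀ f, ‖L f‖ ≤ 2 * √totalConst * B * ‖integrableLp.subtype f‖ := fun f => by
    have h := ENNReal.toReal_mono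
      (ENNReal.mul_lt_top ENNReal.ofReal_lt_top (Lp.eLpNorm_lt_top _)).ne (hbound f)
    rw [ENNReal.toReal_mul, ENNReal.toReal_ofReal (by positivity)] at h
    change ‖(hmem f).toLp _‖ ≤ _
    rw [Lp.norm_toLp]
    exact h
  refine ⟨L.extendOfNorm integrableLp.subtype, fun f hf => ?_,
    LinearMap.opNorm_extendOfNorm_le denseRange_integrableLp (by positivity) hL⟩
  have e := LinearMap.extendOfNorm_eq denseRange_integrableLp ⟨_, hL⟩ ⟨f, hf⟩
  have e' : L.extendOfNorm integrableLp.subtype f = (hmem ⟨f, hf⟩).toLp _ := e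
  rw [e']
  exact (MemLp.coeFn_toLp _).trans (hae f).symm
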